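/- Let $n\ge 0$ and let $A(-\infty),A(+\infty)\in\mathbb{R}^{n\times n}$ be symmetric invertible matrices. For a symmetric matrix $M$ let $\mathrm{ind}\,M$ denote its negative index of inertia, i.e. the maximal dimension of a subspace on which $x\mapsto x^{T}Mx$ is negative definite. A bounded operator is Fredholm if it has finite-dimensional kernel and closed range of finite codimension; its index is $\dim\ker-\dim\mathrm{coker}$. (a) Let $A:\mathbb{R}\to\mathbb{R}^{n\times n}$ be continuous with $\lim_{t\to\pm\infty}A(t)=A(\pm\infty)$. Then the bounded operator $$F_A:W^{1,2}(\mathbb{R},\mathbb{R}^n)\to L^2(\mathbb{R},\mathbb{R}^n),\qquad (F_A\xi)(t)=\dot\xi(t)+A(t)\xi(t),$$ is Fredholm with index $\mathrm{ind}\,A(-\infty)-\mathrm{ind}\,A(+\infty)$. (b) Let $\ell\ge 0$, and for every $\mathbf{s}\in[0,1]^{\ell}$ let $A(\mathbf{s},\cdot):\mathbb{R}\to\mathbb{R}^{n\times n}$ be continuous with $\lim_{t\to\pm\infty}A(\mathbf{s},t)=A(\pm\infty)$. Then for every $\mathbf{s}\in[0,1]^\ell$ and every linear map $K:\mathbb{R}^{\ell}\to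 L^2(\mathbb{R},\mathbb{R}^n)$ (the derivative in the directions of the parameters; $K=0$ is allowed) the bounded operator $$F_{[\ell]A}:\mathbb{R}^{\ell}\times W^{1,2}(\mathbb{R},\mathbb{R}^n)\to L^2(\mathbb{R},\mathbb{R}^n),\qquad F_{[\ell]A}(\sigma,\xi)(t)=\dot\xi(t)+A(\mathbf{s},t)\xi(t)+(K\sigma)(t),$$ is Fredholm with index $\mathrm{ind}\,A(-\infty)-\mathrm{ind}\,A(+\infty)+\ell$. -/

import Mathlib

open MeasureTheory Filter Topology
open scoped ContDiff ENNReal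

noncomputable section

namespace FredholmLine

/-- The Hilbert space `L²(ℝ, ℝⁿ)`, where `ℝⁿ` carries the Euclidean norm. -/
abbrev L2 (n : ℕ) : Type :=
  Lp (EuclideanSpace ℝ (Fin n)) 2 (volume : Measure ℝ)

/-- `g` is the weak derivative of `f` on `ℝ`: `∫ φ' f = - ∫ φ g` for all test functions
`φ ∈ C_c^∞(ℝ)`. -/
def IsWeakDeriv {n : ℕ} (f g : ℝ → EuclideanSpace ℝ (Fin n)) : Prop :=
  ∀ φ : ℝ → ℝ, ContDiff ℝ ∞ φ → HasCompactSupport φ →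
    ∫ t, deriv φ t • f t = - ∫ t, φ t • g t

theorem integrable_smul_L2 {n : ℕ} {φ : ℝ → ℝ} (hφ : Continuous φ) (hc : HasCompactSupport φ)
    (f : L2 n) : Integrable (fun t => φ t • f t) := by
  have h1 : MemLp φ 2 (volume : Measure ℝ) := hφ.memLp_of_hasCompactSupport hc
  have h2 := (Lp.memLp f).smul (r := 1) h1
  exact memLp_one_iff_integrable.1 h2

/-- The Sobolev space `W^{1,2}(ℝ, ℝⁿ)`, realised as the graph of the weak derivative: its elements
are the pairs `(ξ, ξ')` with `ξ ∈ L²` whose weak derivative `ξ'` is in `L²` (and is determined by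
`ξ`). The norm inherited from the Hilbert sum `L² ⊕ L²` is the usual Sobolev norm
`(‖ξ‖² + ‖ξ'‖²)^{1/2}`. -/
def W12 (n : ℕ) : Submodule ℝ (WithLp 2 (L2 n × L2 n)) where
  carrier := {p | IsWeakDeriv (p.fst : ℝ → EuclideanSpace ℝ (Fin n)) p.snd}
  zero_mem' := by
    intro φ _ _
    have h := Lp.coeFn_zero (EuclideanSpace ℝ (Fin n)) 2 (volume : Measure ℝ)
    have h1 : ∀ ψ : ℝ → ℝ, ∫ t, ψ t • (0 : L2 n) t = 0 := fun ψ => by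
      rw [integral_eq_zero_of_ae]
      filter_upwards [h] with t ht
      rw [ht]
      simp
    simp only [WithLp.zero_fst, WithLp.zero_snd]
    rw [h1, h1, neg_zero]
  add_mem' := by
    intro p q hp hq φ hφ hc
    have hd : Continuous (deriv φ) := hφ.continuous_deriv (by simp)
    have key : ∀ ψ : ℝ → ℝ, Continuous ψ → HasCompactSupport ψ → ∀ f g : L2 n,
        ∫ t, ψ t • (f + g : L2 n) t = (∫ t, ψ t • f t) + ∫ t, ψ t • g t := by
      intro ψ h1 h2 f g
      rw [← integral_add (integrable_smul_L2 h1 h2 f) (integrable_smul_L2 h1 h2 g)]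
      refine integral_congr_ae ?_
      filter_upwards [Lp.coeFn_add f g] with t ht
      rw [ht, Pi.add_apply, smul_add]
    simp only [WithLp.add_fst, WithLp.add_snd]
    rw [key _ hd hc.deriv, key _ hφ.continuous hc, hp φ hφ hc, hq φ hφ hc, neg_add]
  smul_mem' := by
    intro c p hp φ hφ hc
    have key : ∀ (ψ : ℝ → ℝ) (f : L2 n),
        ∫ t, ψ t • (c • f : L2 n) t = c • ∫ t, ψ t • f t := by
      intro ψ f
      rw [← integral_smul]
      refine integral_congr_ae ?_
      filter_upwards [Lp.coeFn_smul c f] with t ht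
      rw [ht, Pi.smul_apply, smul_comm]
    simp only [WithLp.smul_fst, WithLp.smul_snd]
    rw [key, key, hp φ hφ hc, smul_neg]

/-- The inclusion `W^{1,2} → L²`, `ξ ↦ ξ`. -/
def W12.incl (n : ℕ) : W12 n →L[ℝ] L2 n :=
  (WithLp.fstL 2 ℝ (L2 n) (L2 n)).comp (W12 n).subtypeL

/-- The weak derivative `∂ₜ : W^{1,2} → L²`, `ξ ↦ ξ'`. -/
def W12.dt (n : ℕ) : W12 n →L[ℝ] L2 n :=
  (WithLp.sndL 2 ℝ (L2 n) (L2 n)).comp (W12 n).subtypeL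

/-- The linear map of `ℝⁿ` given by a square matrix. -/
abbrev act {n : ℕ} (M : Matrix (Fin n) (Fin n) ℝ) :
    EuclideanSpace ℝ (Fin n) →L[ℝ] EuclideanSpace ℝ (Fin n) :=
  Matrix.toEuclideanCLM (𝕜 := ℝ) M

theorem continuous_act {n : ℕ} :
    Continuous (act : Matrix (Fin n) (Fin n) ℝ → _) :=
  LinearMap.continuous_of_finiteDimensional
    ((Matrix.toEuclideanCLM (n := Fin n) (𝕜 := ℝ)).toAlgEquiv.toLinearMap)

/-- A continuous path of matrices with limits at `±∞` is bounded. -/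
theorem exists_bound {n : ℕ} {A : ℝ → Matrix (Fin n) (Fin n) ℝ} (hA : Continuous A)
    {Am Ap : Matrix (Fin n) (Fin n) ℝ} (hm : Tendsto A atBot (𝓝 Am))
    (hp : Tendsto A atTop (𝓝 Ap)) : ∃ C, ∀ t, ‖act (A t)‖ ≤ C := by
  have hc : Continuous fun t => ‖act (A t)‖ := (continuous_act.comp hA).norm
  have h1 : Tendsto (fun t => ‖act (A t)‖) atBot (𝓝 ‖act Am‖) :=
    ((continuous_act.tendsto Am).comp hm).norm
  have h2 : Tendsto (fun t => ‖act (A t)‖) atTop (𝓝 ‖act Ap‖) :=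
    ((continuous_act.tendsto Ap).comp hp).norm
  obtain ⟨a, ha⟩ := eventually_atBot.1 (h1.eventually_le_const (lt_add_one _))
  obtain ⟨b, hb⟩ := eventually_atTop.1 (h2.eventually_le_const (lt_add_one _))
  obtain ⟨C, hC⟩ := (isCompact_Icc (a := a) (b := b)).bddAbove_image hc.continuousOn
  refine ⟨max (max (‖act Am‖ + 1) (‖act Ap‖ + 1)) C, fun t => ?_⟩
  rcases le_total t a with h | h
  · exact (ha t h).trans ((le_max_left _ _).trans (le_max_left _ _))
  rcases le_total b t with h' | h'
  · exact (hb t h').trans ((le_max_right _ _).trans (le_max_left _ _))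
  · exact (hC ⟨t, ⟨h, h'⟩, rfl⟩).trans (le_max_right _ _)

theorem memLp_act {n : ℕ} {A : ℝ → Matrix (Fin n) (Fin n) ℝ} (hA : Continuous A)
    (hb : ∃ C, ∀ t, ‖act (A t)‖ ≤ C) (f : L2 n) :
    MemLp (fun t => act (A t) (f t)) 2 (volume : Measure ℝ) := by
  obtain ⟨C, hC⟩ := hb
  refine (Lp.memLp f).of_le_mul (c := C) ?_ (ae_of_all _ fun t => ?_)
  · have h1 : AEStronglyMeasurable (fun t => act (A t)) (volume : Measure ℝ) :=
      (continuous_act.comp hA).aestronglyMeasurable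
    exact (isBoundedBilinearMap_apply (𝕜 := ℝ)).continuous.comp_aestronglyMeasurable
      (h1.prodMk (Lp.aestronglyMeasurable f))
  · exact ((act (A t)).le_opNorm _).trans (mul_le_mul_of_nonneg_right (hC t) (norm_nonneg _))

/-- The multiplication operator `f ↦ A(·) f(·)` on `L²(ℝ, ℝⁿ)`, for `A` continuous and bounded. -/
def mulOp {n : ℕ} (A : ℝ → Matrix (Fin n) (Fin n) ℝ) (hA : Continuous A)
    (hb : ∃ C, ∀ t, ‖act (A t)‖ ≤ C) : L2 n →L[ℝ] L2 n :=
  LinearMap.mkContinuousOfExistsBound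
    { toFun := fun f => (memLp_act hA hb f).toLp
      map_add' := fun f g => by
        rw [← MemLp.toLp_add, MemLp.toLp_eq_toLp_iff]
        filter_upwards [Lp.coeFn_add f g] with t ht
        simp only [ht, Pi.add_apply, map_add]
      map_smul' := fun c f => by
        rw [RingHom.id_apply, ← MemLp.toLp_const_smul, MemLp.toLp_eq_toLp_iff]
        filter_upwards [Lp.coeFn_smul c f] with t ht
        simp only [ht, Pi.smul_apply, map_smul] }
    (by
      obtain ⟨C, hC⟩ := hb
      refine ⟨C, fun f => Lp.norm_le_mul_norm_of_ae_le_mul ?_⟩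
      filter_upwards [(memLp_act hA ⟨C, hC⟩ f).coeFn_toLp] with t ht
      simp only [LinearMap.coe_mk, AddHom.coe_mk, ht]
      exact ((act (A t)).le_opNorm _).trans
        (mul_le_mul_of_nonneg_right (hC t) (norm_nonneg _)))

/-- The operator `F_A = ∂ₜ + A(t) : W^{1,2}(ℝ, ℝⁿ) → L²(ℝ, ℝⁿ)`, for `A` continuous and
bounded. -/
def opF {n : ℕ} (A : ℝ → Matrix (Fin n) (Fin n) ℝ) (hA : Continuous A)
    (hb : ∃ C, ∀ t, ‖act (A t)‖ ≤ C) : W12 n →L[ℝ] L2 n :=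
  W12.dt n + (mulOp A hA hb).comp (W12.incl n)

/-- The parametrized operator `(σ, ξ) ↦ ξ' + A(t) ξ + K σ` on `ℝ^ℓ × W^{1,2}(ℝ, ℝⁿ)`: the shape of
the linearization, in the `ℓ` parameters and the path together, of a parametrized gradient flow
equation. `K σ` is the derivative of the equation in the direction `σ` of the parameters. -/
def opFParam {n : ℕ} (l : ℕ) (A : ℝ → Matrix (Fin n) (Fin n) ℝ) (hA : Continuous A)
    (hb : ∃ C, ∀ t, ‖act (A t)‖ ≤ C) (K : EuclideanSpace ℝ (Fin l) →L[ℝ] L2 n) :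
    (EuclideanSpace ℝ (Fin l) × W12 n) →L[ℝ] L2 n :=
  K.coprod (opF A hA hb)

/-- The index `dim ker T - dim coker T` of a (Fredholm) operator. -/
def fredholmIndex {X Y : Type*} [NormedAddCommGroup X] [NormedSpace ℝ X]
    [NormedAddCommGroup Y] [NormedSpace ℝ Y] (T : X →L[ℝ] Y) : ℤ :=
  (Module.finrank ℝ T.ker : ℤ) - (Module.finrank ℝ (Y ⧸ T.range) : ℤ)

/-- The negative index of inertia of a symmetric real matrix: the maximal dimension of a subspace
on which the quadratic form `x ↦ xᵀ M x` is negative definite. -/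
def negInd {n : ℕ} (M : Matrix (Fin n) (Fin n) ℝ) : ℕ :=
  sigNeg (M.toQuadraticForm' : QuadraticForm ℝ (Fin n → ℝ))

end FredholmLine

end

/-! Replace `A` by the path that equals `A(-∞)` for t < 0 and `A(+∞)` for t ≥ 0. The difference D
tends to zero at ±∞, so multiplication by D on W^{1,2} is a norm limit of finite rank maps: outside
a large interval D is small, and inside it Hölder continuity lets a Sobolev function be replaced by
finitely many samples (`exists_finiteRange_approx`). Such a perturbation changes neither the
Fredholm property nor the index (`IsFredholm.add_of_approx`), so only the step path has to be
computed.

For the step path the equation has constant coefficients on each half-line. In eigenvector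
coordinates its solutions are exponentials, and a solution is square integrable exactly when it
decays at both ends. Evaluation at 0 thus identifies the kernel with U ⊓ V, where U is the positive
eigenspace of `A(+∞)` and V the negative eigenspace of `A(-∞)` (`kerModelEquiv`). The orthogonal
complement of the range is the kernel for the path -A (`orthogonal_range_lineOp`), that is Uᗮ ⊓ Vᗮ.
The index is therefore dim U + dim V - n = ind A(-∞) - ind A(+∞) (`fredholmIndex_model`). The range
has finite codimension because the constant coefficient operators are bijective and their solutions
can be glued at 0 as soon as n linear conditions hold (`isFredholm_model`).

The parametrized operator restricts to F_A on a subspace of codimension ℓ, and additivity of the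
index under composition gives the extra ℓ (`IsFredholm.coprod`). -/

namespace FredholmLine

/-! ### Abstract Fredholm theory: perturbation and added parameters. -/

section Abstract

open LinearMap LinearMap.FiniteRangeSetoid

variable {X Y : Type*} [NormedAddCommGroup X] [NormedSpace ℝ X]
  [NormedAddCommGroup Y] [NormedSpace ℝ Y]

/-- Two linear maps with finite-dimensional kernel and cokernel that differ by a map of finite
rank have the same index. -/
theorem index_eq_of_finiteRange {V W : Type*} [AddCommGroup V] [Module ℝ V] [AddCommGroup W]
    [Module ℝ W] {u v : V →ₗ[ℝ] W} (h : u ≈ v)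
    [FiniteDimensional ℝ u.ker] [FiniteDimensional ℝ (W ⧸ u.range)]
    [FiniteDimensional ℝ v.ker] [FiniteDimensional ℝ (W ⧸ v.range)] : u.index = v.index := by
  -- The maps agree on a subspace S of finite codimension. Composing both with the inclusion of S
  -- gives the same map, so additivity of the index cancels the index of the inclusion.
  set S := eqLocus u v with hS
  have : S.CoFG := equiv_iff_eqLocus_coFG.1 h
  have e : u ∘ₗ S.subtype = v ∘ₗ S.subtype := by
    ext x
    exact x.2
  have : FiniteDimensional ℝ S.subtype.ker := by
    rw [Submodule.ker_subtype]; infer_instance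
  have : FiniteDimensional ℝ (V ⧸ S.subtype.range) := by
    rw [Submodule.range_subtype]; infer_instance
  have h1 := index_comp (f := S.subtype) u
  have h2 := index_comp (f := S.subtype) v
  rw [e] at h1
  lia

theorem fredholmIndex_eq_index (T : X →L[ℝ] Y) : fredholmIndex T = (T : X →ₗ[ℝ] Y).index :=
  LinearMap.index_eq_finrank_sub.symm

/-- A bounded operator between Banach spaces whose kernel and cokernel are finite-dimensional is
a Fredholm operator. -/
theorem isFredholm_of_finite [CompleteSpace X] [CompleteSpace Y] (T : X →L[ℝ] Y)
    [FiniteDimensional ℝ T.ker] [FiniteDimensional ℝ (Y ⧸ T.range)] : T.IsFredholm := by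
  obtain ⟨X₁, hX⟩ := (Submodule.ClosedComplemented.of_finiteDimensional T.ker).exists_isTopCompl
  have hX₁ : IsClosed (X₁ : Set X) := hX.symm.isClosed
  have : X₁.CoFG := Submodule.FG.cofg_of_isCompl hX.isCompl (Module.Finite.iff_fg.1 inferInstance)
  obtain ⟨C, hC⟩ := T.range.exists_isCompl
  have : FiniteDimensional ℝ C := .of_fg (Submodule.CoFG.fg_of_isCompl hC inferInstance)
  have : CompleteSpace X₁ := hX₁.completeSpace_coe
  have hinj : ∀ x ∈ X₁, T x = 0 → x = 0 := fun x hx h0 =>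
    (Submodule.disjoint_def.1 hX.isCompl.disjoint) x h0 hx
  have hr : (T ∘L X₁.subtypeL).range = T.range := by
    apply le_antisymm
    · rintro _ ⟨x, rfl⟩
      exact ⟨x, rfl⟩
    · rintro _ ⟨x, rfl⟩
      obtain ⟨k, hk, y, hy, rfl⟩ := Submodule.mem_sup.1
        (hX.isCompl.sup_eq_top ▸ Submodule.mem_top : x ∈ T.ker ⊔ X₁)
      refine ⟨⟨y, hy⟩, ?_⟩
      have : T k = 0 := hk
      simp [this]
  -- On the closed complement X₁ of the kernel, T is injective with the same range. A range with a
  -- closed complement is closed in that situation, and C is closed because it is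
  -- finite-dimensional.
  have hcl : IsClosed (T.range : Set Y) := by
    rw [← hr] at hC ⊢
    refine (T ∘L X₁.subtypeL).closed_complemented_range_of_isCompl_of_ker_eq_bot C hC
      (Submodule.closed_of_finiteDimensional C) ?_
    rw [LinearMap.ker_eq_bot']
    intro x hx
    exact Subtype.ext (hinj x x.2 hx)
  have hm : Set.MapsTo T X₁ T.range := fun x _ => ⟨x, rfl⟩
  have : CompleteSpace T.range := hcl.completeSpace_coe
  refine ContinuousLinearMap.IsFredholm.of_isInvertible_restrict hX₁ hcl hm ?_
  refine ⟨ContinuousLinearEquiv.ofBijective (T.restrict hm) ?_ ?_, ?_⟩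
  · rw [LinearMap.ker_eq_bot']
    intro x hx
    exact Subtype.ext (hinj x x.2 (congrArg Subtype.val hx))
  · rw [LinearMap.range_eq_top]
    rintro ⟨y, hy⟩
    rw [← hr] at hy
    obtain ⟨x, rfl⟩ := hy
    exact ⟨x, Subtype.ext rfl⟩
  · exact ContinuousLinearEquiv.coe_ofBijective _ _ _

/-- The Fredholm property and the index are stable under perturbations that are norm limits of
finite rank maps. -/
theorem IsFredholm.add_of_approx [CompleteSpace X] [CompleteSpace Y] {T K : X →L[ℝ] Y}
    (hT : T.IsFredholm)
    (hK : ∀ ε > 0, ∃ R : X →ₗ[ℝ] Y, R.HasFiniteRange ∧ ∀ x, ‖K x - R x‖ ≤ ε * ‖x‖) :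
    (T + K).IsFredholm ∧ fredholmIndex (T + K) = fredholmIndex T := by
  obtain ⟨v, hv⟩ := hT.exists_isQuasiInverse
  -- Split K = R + P with R of finite rank and P so small that ‖v‖‖P‖ < 1; the summand 1 covers v =
  -- 0. Modulo finite rank, v(T + K) is then the invertible operator U = 1 + vP.
  obtain ⟨R, hR, hb⟩ := hK (1 / (2 * (‖v‖ + 1))) (by positivity)
  have hb' : ∀ x, ‖(K.toLinearMap - R) x‖ ≤ 1 / (2 * (‖v‖ + 1)) * ‖x‖ := hb
  set P : X →L[ℝ] Y := (K.toLinearMap - R).mkContinuous _ hb' with hP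
  have hPn : ‖P‖ ≤ 1 / (2 * (‖v‖ + 1)) := LinearMap.mkContinuous_norm_le _ (by positivity) _
  have hlt : ‖v‖ * ‖P‖ < 1 := by
    calc ‖v‖ * ‖P‖ ≤ ‖v‖ * (1 / (2 * (‖v‖ + 1))) := by gcongr
      _ < 1 := by
        have := norm_nonneg v
        rw [mul_one_div, div_lt_one (by positivity)]
        linarith
  have h1 : ‖-(v ∘L P)‖ < 1 := by
    rw [norm_neg]; exact (v.opNorm_comp_le P).trans_lt hlt
  let U : (X →L[ℝ] X)ˣ := Units.oneSub _ h1
  have hU : ((U : X →L[ℝ] X) : X →ₗ[ℝ] X) = .id + v.toLinearMap ∘ₗ P.toLinearMap := by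
    ext x; simp [U]
  have hTK : (T + K).toLinearMap ≈ T.toLinearMap + P.toLinearMap := by
    rw [equiv_iff_hasFiniteRange]
    have e : (T + K).toLinearMap - (T.toLinearMap + P.toLinearMap) = R := by
      ext x
      simp [hP]
    rwa [e]
  have hcomp : v.toLinearMap ∘ₗ (T + K).toLinearMap ≈ ((U : X →L[ℝ] X) : X →ₗ[ℝ] X) := by
    refine Setoid.trans (equiv_comp_left hTK) ?_
    rw [equiv_iff_hasNoetherianRange, hU]
    have := equiv_iff_hasNoetherianRange.1 hv.1.equiv
    convert this using 1
    ext x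
    simp
  have hUq : ((U⁻¹ : (X →L[ℝ] X)ˣ) : X →L[ℝ] X).toLinearMap.IsQuasiInverse
      ((U : X →L[ℝ] X) : X →ₗ[ℝ] X) := by
    have e1 : ((U⁻¹ : (X →L[ℝ] X)ˣ) : X →L[ℝ] X).toLinearMap ∘ₗ
        ((U : X →L[ℝ] X) : X →ₗ[ℝ] X) = .id := by
      ext x
      exact congrArg (fun f : X →L[ℝ] X => f x) U.inv_mul
    have e2 : ((U : X →L[ℝ] X) : X →ₗ[ℝ] X) ∘ₗ
        ((U⁻¹ : (X →L[ℝ] X)ˣ) : X →L[ℝ] X).toLinearMap = .id := by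
      ext x
      exact congrArg (fun f : X →L[ℝ] X => f x) U.mul_inv
    refine ⟨?_, ?_⟩
    · rw [IsLeftQuasiInverse, e1]
    · rw [IsRightQuasiInverse, e2]
  have hvTK := hUq.congr (Setoid.refl _) hcomp
  have hF : (T + K).IsFredholm :=
    .of_isQuasiInverse (v := ((U⁻¹ : (X →L[ℝ] X)ˣ) : X →L[ℝ] X) ∘L v)
      (IsQuasiInverse.of_comp_right hv.symm hvTK)
  refine ⟨hF, ?_⟩
  have hvF : v.IsFredholm := .of_isQuasiInverse hv.symm
  have hUF : (U : X →L[ℝ] X).IsFredholm := .of_isQuasiInverse hUq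
  have hcF : (v ∘L (T + K)).IsFredholm := .of_isQuasiInverse hvTK
  have hcF' : (v ∘L T).IsFredholm :=
    .of_isQuasiInverse (v := ContinuousLinearMap.id ℝ X) (by
      constructor
      · simpa [IsLeftQuasiInverse] using hv.1
      · exact hv.1.equiv)
  have hU0 : ((U : X →L[ℝ] X) : X →ₗ[ℝ] X).index = 0 :=
    LinearEquiv.index_eq_zero (e := (ContinuousLinearEquiv.ofUnit U).toLinearEquiv)
  have i1 := hF.finite_ker
  have i2 := hF.finite_coker
  have i3 := hvF.finite_ker
  have i4 := hvF.finite_coker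
  have i5 := hT.finite_ker
  have i6 := hT.finite_coker
  have i7 := hUF.finite_ker
  have i8 := hUF.finite_coker
  have i9 : FiniteDimensional ℝ (v.toLinearMap ∘ₗ (T + K).toLinearMap).ker := hcF.finite_ker
  have i10 : FiniteDimensional ℝ (X ⧸ (v.toLinearMap ∘ₗ (T + K).toLinearMap).range) :=
    hcF.finite_coker
  have i11 : FiniteDimensional ℝ (v.toLinearMap ∘ₗ T.toLinearMap).ker := hcF'.finite_ker
  have i12 : FiniteDimensional ℝ (X ⧸ (v.toLinearMap ∘ₗ T.toLinearMap).range) :=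
    hcF'.finite_coker
  -- Both v(T + K) and vT have index 0, being finite rank perturbations of U and of the identity.
  -- Additivity makes the indices of T + K and of T both equal to minus that of v.
  have a1 := index_comp (f := (T + K).toLinearMap) v.toLinearMap
  have a2 := index_comp (f := T.toLinearMap) v.toLinearMap
  have a3 : (v.toLinearMap ∘ₗ (T + K).toLinearMap).index = _ := index_eq_of_finiteRange hcomp
  have : FiniteDimensional ℝ (LinearMap.id : X →ₗ[ℝ] X).ker := by
    rw [LinearMap.ker_id]; infer_instance
  have : FiniteDimensional ℝ (X ⧸ (LinearMap.id : X →ₗ[ℝ] X).range) := by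
    rw [LinearMap.range_id]; infer_instance
  have a4 : (v.toLinearMap ∘ₗ T.toLinearMap).index = _ := index_eq_of_finiteRange hv.1.equiv
  rw [index_id] at a4
  rw [fredholmIndex_eq_index, fredholmIndex_eq_index]
  lia

/-- Adding `l` parameters to a Fredholm operator gives a Fredholm operator whose index is larger
by `l`. -/
theorem IsFredholm.coprod {Z : Type*} [NormedAddCommGroup Z] [NormedSpace ℝ Z]
    [FiniteDimensional ℝ Z] [CompleteSpace X] [CompleteSpace Y] {T : X →L[ℝ] Y}
    (hT : T.IsFredholm) (K : Z →L[ℝ] Y) :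
    (K.coprod T).IsFredholm ∧
      fredholmIndex (K.coprod T) = fredholmIndex T + Module.finrank ℝ Z := by
  have i1 := hT.finite_ker
  have i2 := hT.finite_coker
  have hc : (K.coprod T).toLinearMap ∘ₗ LinearMap.inr ℝ Z X = T.toLinearMap := by
    ext x; simp
  have i3 : FiniteDimensional ℝ (Y ⧸ (K.coprod T).range) := by
    refine Submodule.CoFG.of_le ?_ i2
    rw [← hc]
    exact LinearMap.range_comp_le_range _ _
  have i4 : FiniteDimensional ℝ (LinearMap.inr ℝ Z X).ker := by
    rw [LinearMap.ker_eq_bot.2 LinearMap.inr_injective]; infer_instance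
  have hq : (LinearMap.inr ℝ Z X).range = (LinearMap.fst ℝ Z X).ker := LinearMap.range_inr ℝ Z X
  let e : ((Z × X) ⧸ (LinearMap.inr ℝ Z X).range) ≃ₗ[ℝ] Z :=
    (Submodule.quotEquivOfEq _ _ hq).trans
      ((LinearMap.fst ℝ Z X).quotKerEquivOfSurjective LinearMap.fst_surjective)
  have i5 : FiniteDimensional ℝ ((Z × X) ⧸ (LinearMap.inr ℝ Z X).range) :=
    Module.Finite.equiv e.symm
  have i6 : FiniteDimensional ℝ (K.coprod T).ker := by
    rw [← Submodule.fg_iff_finiteDimensional]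
    refine Submodule.fg_of_fg_map_of_fg_inf_ker (LinearMap.fst ℝ Z X)
      (IsNoetherian.noetherian _) ?_
    have e : (K.coprod T).ker ⊓ (LinearMap.fst ℝ Z X).ker = T.ker.map (LinearMap.inr ℝ Z X) := by
      ext ⟨z, x⟩
      constructor
      · rintro ⟨h1, h2⟩
        obtain rfl : z = 0 := h2
        refine ⟨x, ?_, rfl⟩
        simpa using h1
      · rintro ⟨y, hy, h⟩
        obtain ⟨rfl, rfl⟩ := Prod.ext_iff.1 h
        have hy : T y = 0 := hy
        constructor <;> simp [hy]
    rw [e]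
    exact Submodule.FG.map _ (Module.Finite.iff_fg.1 i1)
  refine ⟨isFredholm_of_finite _, ?_⟩
  -- T is the composite of `K.coprod T` with the inclusion of X, which is injective with cokernel Z
  -- and hence has index -dim Z.
  have a1 := index_comp (f := LinearMap.inr ℝ Z X) (K.coprod T).toLinearMap
  have a2 := LinearMap.index_of_injective (f := LinearMap.inr ℝ Z X) LinearMap.inr_injective
  rw [e.finrank_eq] at a2
  rw [hc, a2] at a1
  rw [fredholmIndex_eq_index, fredholmIndex_eq_index]
  lia

end Abstract

/-! ### Primitives of locally integrable functions and integration by parts. -/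

section Primitive

variable {V : Type*} [NormedAddCommGroup V] [NormedSpace ℝ V]

/-- `F` is a primitive of the locally integrable function `f`. -/
structure IsPrimitive (F f : ℝ → V) : Prop where
  locInt : LocallyIntegrable f
  integral_eq : ∀ a b, ∫ t in a..b, f t = F b - F a

theorem IsPrimitive.intervalIntegrable {F f : ℝ → V} (h : IsPrimitive F f) (a b : ℝ) :
    IntervalIntegrable f volume a b :=
  intervalIntegrable_iff.2 ((h.locInt.integrableOn_isCompact isCompact_uIcc).mono_set
    Set.uIoc_subset_uIcc)

theorem isPrimitive_integral {f : ℝ → V} (hf : LocallyIntegrable f) (c : V) :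
    IsPrimitive (fun t => c + ∫ s in (0 : ℝ)..t, f s) f where
  locInt := hf
  integral_eq a b := by
    have hi : ∀ x y : ℝ, IntervalIntegrable f volume x y := fun x y =>
      intervalIntegrable_iff.2 ((hf.integrableOn_isCompact isCompact_uIcc).mono_set
        Set.uIoc_subset_uIcc)
    rw [add_sub_add_left_eq_sub, intervalIntegral.integral_interval_sub_left (hi _ _) (hi _ _)]

theorem IsPrimitive.eq_add_integral {F f : ℝ → V} (h : IsPrimitive F f) (a t : ℝ) :
    F t = F a + ∫ s in a..t, f s := by
  rw [h.integral_eq]; abel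

theorem IsPrimitive.continuous {F f : ℝ → V} (h : IsPrimitive F f) : Continuous F := by
  have : F = fun t => F 0 + ∫ s in (0 : ℝ)..t, f s := funext fun t => h.eq_add_integral 0 t
  rw [this]
  exact continuous_const.add (intervalIntegral.continuous_primitive h.intervalIntegrable 0)

theorem IsPrimitive.clm_comp {W : Type*} [NormedAddCommGroup W] [NormedSpace ℝ W]
    [CompleteSpace V] [CompleteSpace W] {F f : ℝ → V} (h : IsPrimitive F f) (L : V →L[ℝ] W) :
    IsPrimitive (fun t => L (F t)) (fun t => L (f t)) where
  locInt := fun x => by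
    obtain ⟨s, hs, hi⟩ := h.locInt x
    exact ⟨s, hs, L.integrable_comp hi⟩
  integral_eq a b := by
    rw [L.intervalIntegral_comp_comm (h.intervalIntegrable a b), h.integral_eq, map_sub]

theorem IsPrimitive.absolutelyContinuous {F f : ℝ → ℝ} (h : IsPrimitive F f) (a b : ℝ) :
    AbsolutelyContinuousOnInterval F a b := by
  have hi := (h.intervalIntegrable a b).absolutelyContinuousOnInterval_intervalIntegral
    (c := a) Set.left_mem_uIcc
  have hc : AbsolutelyContinuousOnInterval (fun _ : ℝ => F a) a b :=
    (contDiffOn_const (c := F a)).absolutelyContinuousOnInterval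
  have e : F = (fun _ => F a) + fun t => ∫ s in a..t, f s :=
    funext fun t => h.eq_add_integral a t
  rw [e]
  exact hc.add hi

theorem IsPrimitive.ae_hasDerivAt [CompleteSpace V] {F f : ℝ → V} (h : IsPrimitive F f) :
    ∀ᵐ t, HasDerivAt F (f t) t := by
  filter_upwards [_root_.LocallyIntegrable.ae_hasDerivAt_integral h.locInt] with t ht
  have : F = fun t => F 0 + ∫ s in (0 : ℝ)..t, f s := funext fun t => h.eq_add_integral 0 t
  rw [this]
  exact (ht 0).const_add _

theorem locallyIntegrable_mul_continuous {f g : ℝ → ℝ} (hf : LocallyIntegrable f)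
    (hg : Continuous g) : LocallyIntegrable (fun t => f t * g t) := by
  rw [← locallyIntegrableOn_univ] at hf ⊢
  exact hf.mul_continuousOn hg.continuousOn isOpen_univ.isLocallyClosed

/-- Primitives are absolutely continuous, so integration by parts on intervals applies, with a.e.
derivatives given by Lebesgue differentiation. -/
theorem IsPrimitive.mul {F f G g : ℝ → ℝ} (hF : IsPrimitive F f) (hG : IsPrimitive G g) :
    IsPrimitive (fun t => F t * G t) (fun t => f t * G t + g t * F t) where
  locInt := (locallyIntegrable_mul_continuous hF.locInt hG.continuous).add
    (locallyIntegrable_mul_continuous hG.locInt hF.continuous)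
  integral_eq a b := by
    rw [← (hF.absolutelyContinuous a b).integral_deriv_mul_eq_sub (hG.absolutelyContinuous a b)]
    refine intervalIntegral.integral_congr_ae ?_
    filter_upwards [hF.ae_hasDerivAt, hG.ae_hasDerivAt] with t h1 h2 _
    rw [h1.deriv, h2.deriv]
    ring

theorem IsPrimitive.sum {ι : Type*} (s : Finset ι) {F f : ι → ℝ → V}
    (h : ∀ i, IsPrimitive (F i) (f i)) :
    IsPrimitive (fun t => ∑ i ∈ s, F i t) (fun t => ∑ i ∈ s, f i t) where
  locInt := locallyIntegrable_finsetSum s fun i _ => (h i).locInt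
  integral_eq a b := by
    rw [intervalIntegral.integral_finsetSum fun i _ => (h i).intervalIntegrable a b,
      ← Finset.sum_sub_distrib]
    exact Finset.sum_congr rfl fun i _ => (h i).integral_eq a b

/-- The product rule for the inner product of primitives. -/
theorem IsPrimitive.inner_prod {n : ℕ} {F f G g : ℝ → EuclideanSpace ℝ (Fin n)}
    (hF : IsPrimitive F f) (hG : IsPrimitive G g) :
    IsPrimitive (fun t => inner ℝ (F t) (G t))
      (fun t => inner ℝ (f t) (G t) + inner ℝ (F t) (g t)) := by
  have h := IsPrimitive.sum Finset.univ fun i : Fin n =>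
    ((hF.clm_comp (EuclideanSpace.proj i)).mul (hG.clm_comp (EuclideanSpace.proj i)))
  convert h using 2
  · simp [PiLp.inner_apply, mul_comm]
  · simp [PiLp.inner_apply, Finset.sum_add_distrib, mul_comm]

theorem isPrimitive_of_contDiff [CompleteSpace V] {F : ℝ → V} (hF : ContDiff ℝ 1 F) :
    IsPrimitive F (deriv F) where
  locInt := (hF.continuous_deriv le_rfl).locallyIntegrable
  integral_eq a b := intervalIntegral.integral_deriv_eq_sub
    (fun _ _ => (hF.differentiable one_ne_zero).differentiableAt)
    ((hF.continuous_deriv le_rfl).intervalIntegrable a b)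

theorem isPrimitive_smul_const [CompleteSpace V] {φ : ℝ → ℝ} (hφ : ContDiff ℝ 1 φ) (e : V) :
    IsPrimitive (fun t => φ t • e) (fun t => deriv φ t • e) := by
  simpa using (isPrimitive_of_contDiff hφ).clm_comp (ContinuousLinearMap.toSpanSingleton ℝ e)

/-- If a primitive and its derivative are integrable on the line, then the derivative has
integral zero. -/
theorem IsPrimitive.integral_eq_zero {F f : ℝ → ℝ} (h : IsPrimitive F f) (hF : Integrable F)
    (hf : Integrable f) : ∫ t, f t = 0 := by
  have h1 : Tendsto (fun R : ℝ => ∫ t in (-R)..R, f t) atTop (𝓝 (∫ t, f t)) :=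
    intervalIntegral_tendsto_integral hf tendsto_neg_atTop_atBot tendsto_id
  have h2 : Integrable (fun R : ℝ => F R - F (-R)) := hF.sub hF.comp_neg
  simp_rw [h.integral_eq] at h1
  -- The integrals over [-R, R] equal F(R) - F(-R), which is integrable in R; its limit can only be
  -- 0. No separate decay statement for F is needed.
  refine IntegrableAtFilter.eq_zero_of_tendsto (l := atTop) (μ := volume)
    (h2.integrableAtFilter atTop) ?_ h1
  intro s hs
  obtain ⟨a, ha⟩ := mem_atTop_sets.1 hs
  rw [eq_top_iff, ← Real.volume_Ici (a := a)]
  exact measure_mono fun x hx => ha x hx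

end Primitive

/-! ### Weak derivatives: primitives have them, and a vanishing one forces constancy. -/

section WeakDeriv

variable {n : ℕ}

theorem locallyIntegrable_L2 (f : L2 n) : LocallyIntegrable f :=
  (Lp.memLp f).locallyIntegrable (by norm_num)

/-- A primitive has its derivative as weak derivative. -/
theorem IsPrimitive.isWeakDeriv {F f : ℝ → EuclideanSpace ℝ (Fin n)} (h : IsPrimitive F f) :
    IsWeakDeriv F f := by
  intro φ hφ hc
  have hd : Continuous (deriv φ) := hφ.continuous_deriv (by simp)
  have i1 : Integrable (fun t => deriv φ t • F t) :=
    (hd.smul h.continuous).integrable_of_hasCompactSupport hc.deriv.smul_right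
  have i2 : Integrable (fun t => φ t • f t) :=
    h.locInt.integrable_smul_left_of_hasCompactSupport hφ.continuous hc
  rw [eq_neg_iff_add_eq_zero, ← integral_add i1 i2]
  refine ext_inner_left ℝ fun e => ?_
  have hG := isPrimitive_smul_const (hφ.of_le (by simp)) e
  have hp := hG.inner_prod h
  have j1 : Integrable fun t => inner ℝ (φ t • e) (F t) := by
    refine Continuous.integrable_of_hasCompactSupport
      ((hφ.continuous.smul continuous_const).inner h.continuous) (hc.mono fun t ht h0 => ht ?_)
    simp [h0]
  have e1 : (fun t => inner ℝ (deriv φ t • e) (F t) + inner ℝ (φ t • e) (f t)) =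
      fun t => inner ℝ e (deriv φ t • F t + φ t • f t) := by
    ext t
    simp only [inner_smul_left, inner_smul_right, inner_add_right]
    simp
  rw [e1] at hp
  have i3 : Integrable fun t => deriv φ t • F t + φ t • f t := i1.add i2
  rw [inner_zero_right, ← integral_inner i3]
  exact hp.integral_eq_zero j1 (i3.const_inner e)

/-- A locally integrable function with zero weak derivative is constant. -/
theorem ae_eq_const_of_weakDeriv_zero {h : ℝ → EuclideanSpace ℝ (Fin n)}
    (hh : LocallyIntegrable h)
    (h0 : ∀ φ : ℝ → ℝ, ContDiff ℝ ∞ φ → HasCompactSupport φ → ∫ t, deriv φ t • h t = 0) :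
    ∃ c, ∀ᵐ t, h t = c := by
  let b : ContDiffBump (0 : ℝ) := ⟨1, 2, one_pos, one_lt_two⟩
  set ψ : ℝ → ℝ := b.normed volume with hψ
  have hψs : ContDiff ℝ ∞ ψ := b.contDiff_normed
  have hψc : HasCompactSupport ψ := b.hasCompactSupport_normed
  have hψ1 : ∫ t, ψ t = 1 := b.integral_normed
  have hi : ∀ φ : ℝ → ℝ, ContDiff ℝ ∞ φ → HasCompactSupport φ → Integrable fun t => φ t • h t :=
    fun φ h1 h2 => hh.integrable_smul_left_of_hasCompactSupport h1.continuous h2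
  -- A test function of mean zero is the derivative of a test function: its primitive from the left
  -- of the support vanishes again to the right of it.
  have hz : ∀ θ : ℝ → ℝ, ContDiff ℝ ∞ θ → HasCompactSupport θ → ∫ t, θ t = 0 →
      ∫ t, θ t • h t = 0 := by
    intro θ hθ hc hI
    obtain ⟨R₀, hR₀⟩ := hc.isCompact.isBounded.subset_closedBall 0
    obtain ⟨R, hR, hRpos⟩ : ∃ R, R₀ < R ∧ 0 < R :=
      ⟨|R₀| + 1, by linarith [le_abs_self R₀], by positivity⟩
    have hout : ∀ t, R ≤ |t| → θ t = 0 := fun t ht => by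
      by_contra h'
      have := hR₀ (subset_tsupport θ h')
      rw [mem_closedBall_zero_iff, Real.norm_eq_abs] at this
      linarith
    set Θ : ℝ → ℝ := fun t => ∫ s in (-R)..t, θ s with hΘ
    have hd : ∀ t, HasDerivAt Θ (θ t) t := fun t =>
      intervalIntegral.integral_hasDerivAt_right (hθ.continuous.intervalIntegrable _ _)
        (hθ.continuous.stronglyMeasurableAtFilter _ _) hθ.continuous.continuousAt
    have hdΘ : deriv Θ = θ := funext fun t => (hd t).deriv
    have hΘs : ContDiff ℝ ∞ Θ := by
      rw [contDiff_infty_iff_deriv, hdΘ]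
      exact ⟨fun t => (hd t).differentiableAt, hθ⟩
    have hΘc : HasCompactSupport Θ := by
      refine HasCompactSupport.intro (isCompact_closedBall (0 : ℝ) R) fun t ht => ?_
      rw [mem_closedBall_zero_iff, Real.norm_eq_abs, not_le, lt_abs] at ht
      rcases ht with ht | ht
      · have : ∫ s in (-R)..t, θ s = ∫ s, θ s := by
          refine intervalIntegral.integral_eq_integral_of_support_subset fun s hs => ?_
          have hs' := abs_lt.1 (not_le.1 fun h' => hs (hout s h'))
          exact ⟨hs'.1, by linarith⟩
        rw [hΘ]
        simp only [this, hI]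
      · refine intervalIntegral.integral_zero_ae (ae_of_all _ fun s hs => hout s ?_)
        rw [Set.uIoc_of_ge (by linarith)] at hs
        exact le_abs.2 (Or.inr (by linarith [hs.2]))
    have := h0 Θ hΘs hΘc
    rwa [hdΘ] at this
  refine ⟨∫ t, ψ t • h t, ?_⟩
  have hc : LocallyIntegrable fun _ : ℝ => ∫ t, ψ t • h t := continuous_const.locallyIntegrable
  refine ae_eq_of_integral_contDiff_smul_eq hh hc fun φ h1 h2 => ?_
  have hφi : Integrable φ := h1.continuous.integrable_of_hasCompactSupport h2
  have hψi : Integrable ψ := hψs.continuous.integrable_of_hasCompactSupport hψc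
  -- Subtracting the right multiple of the normalized bump ψ makes φ of mean zero, so ∫ φ h = (∫
  -- φ)(∫ ψ h) and the constant is ∫ ψ h.
  have := hz (fun t => φ t - (∫ s, φ s) * ψ t) (h1.sub (contDiff_const.mul hψs))
    (h2.sub (hψc.mul_left)) (by
      rw [integral_sub hφi (hψi.const_mul _), integral_const_mul, hψ1]; ring)
  simp only [sub_smul, mul_smul] at this
  rw [integral_sub (hi φ h1 h2) ((hi ψ hψs hψc).fun_smul _), integral_smul, sub_eq_zero] at this
  rw [this, integral_smul_const]

end WeakDeriv

/-! ### The space W^{1,2}: continuous representatives, Hölder bound, completeness. -/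

section Sobolev

variable {n : ℕ}

theorem IsWeakDeriv.congr {f g f' g' : ℝ → EuclideanSpace ℝ (Fin n)} (h : IsWeakDeriv f g)
    (hf : f =ᵐ[volume] f') (hg : g =ᵐ[volume] g') : IsWeakDeriv f' g' := by
  intro φ hφ hc
  have h1 : ∫ t, deriv φ t • f' t = ∫ t, deriv φ t • f t :=
    integral_congr_ae (by filter_upwards [hf] with t ht; rw [ht])
  have h2 : ∫ t, φ t • g' t = ∫ t, φ t • g t :=
    integral_congr_ae (by filter_upwards [hg] with t ht; rw [ht])
  rw [h1, h2, h φ hφ hc]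

theorem W12.isWeakDeriv (p : W12 n) : IsWeakDeriv (W12.incl n p) (W12.dt n p) := p.2

/-- Square integrable functions `f`, `g` such that `g` is the weak derivative of `f` define an
element of the Sobolev space. -/
theorem W12.exists_of_isWeakDeriv {f g : ℝ → EuclideanSpace ℝ (Fin n)} (h : IsWeakDeriv f g)
    (hf : MemLp f 2 volume) (hg : MemLp g 2 volume) :
    ∃ p : W12 n, W12.incl n p =ᵐ[volume] f ∧ W12.dt n p =ᵐ[volume] g :=
  ⟨⟨WithLp.toLp 2 (hf.toLp f, hg.toLp g),
    h.congr hf.coeFn_toLp.symm hg.coeFn_toLp.symm⟩, hf.coeFn_toLp, hg.coeFn_toLp⟩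

theorem W12.ext_incl_dt {p q : W12 n} (h : W12.incl n p = W12.incl n q)
    (h' : W12.dt n p = W12.dt n q) : p = q :=
  Subtype.ext (WithLp.ofLp_injective 2 (Prod.ext h h'))

theorem W12.norm_sq (p : W12 n) : ‖p‖ ^ 2 = ‖W12.incl n p‖ ^ 2 + ‖W12.dt n p‖ ^ 2 :=
  WithLp.prod_norm_sq_eq_of_L2 (p : WithLp 2 (L2 n × L2 n))

/-- Every element of the Sobolev space has an absolutely continuous representative. -/
theorem W12.exists_primitive (p : W12 n) :
    ∃ F, IsPrimitive F (W12.dt n p) ∧ W12.incl n p =ᵐ[volume] F := by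
  have hg := locallyIntegrable_L2 (W12.dt n p)
  have hf := locallyIntegrable_L2 (W12.incl n p)
  have hG := isPrimitive_integral hg 0
  have hGl : LocallyIntegrable fun t => 0 + ∫ s in (0 : ℝ)..t, W12.dt n p s :=
    hG.continuous.locallyIntegrable
  obtain ⟨c, hc⟩ := ae_eq_const_of_weakDeriv_zero (hf.sub hGl) (by
    intro φ hφ hc
    have hd : Continuous (deriv φ) := hφ.continuous_deriv (by simp)
    simp only [Pi.sub_apply, smul_sub]
    rw [integral_sub (hf.integrable_smul_left_of_hasCompactSupport hd hc.deriv)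
      (hGl.integrable_smul_left_of_hasCompactSupport hd hc.deriv), (W12.isWeakDeriv p) φ hφ hc,
      hG.isWeakDeriv φ hφ hc, sub_self])
  refine ⟨_, isPrimitive_integral hg c, ?_⟩
  filter_upwards [hc] with t ht
  rw [← ht]
  simp

/-- The continuous representative of an element of the Sobolev space. -/
noncomputable def W12.rep (p : W12 n) : ℝ → EuclideanSpace ℝ (Fin n) := (W12.exists_primitive p).choose

theorem W12.isPrimitive_rep (p : W12 n) : IsPrimitive (W12.rep p) (W12.dt n p) :=
  (W12.exists_primitive p).choose_spec.1

theorem W12.incl_ae (p : W12 n) : W12.incl n p =ᵐ[volume] (W12.rep p) :=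
  (W12.exists_primitive p).choose_spec.2

theorem W12.continuous_rep (p : W12 n) : Continuous (W12.rep p) := (W12.isPrimitive_rep p).continuous

theorem W12.memLp_rep (p : W12 n) : MemLp (W12.rep p) 2 volume :=
  (memLp_congr_ae (W12.incl_ae p)).1 (Lp.memLp _)

theorem W12.rep_eq {p : W12 n} {G : ℝ → EuclideanSpace ℝ (Fin n)} (hG : Continuous G)
    (h : W12.incl n p =ᵐ[volume] G) : (W12.rep p) = G :=
  (Continuous.ae_eq_iff_eq volume (W12.continuous_rep p) hG).1 ((W12.incl_ae p).symm.trans h)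

theorem W12.rep_add (p q : W12 n) : W12.rep (p + q) = (W12.rep p) + (W12.rep q) := by
  refine W12.rep_eq ((W12.continuous_rep p).add (W12.continuous_rep q)) ?_
  rw [map_add]
  filter_upwards [Lp.coeFn_add (W12.incl n p) (W12.incl n q), (W12.incl_ae p), (W12.incl_ae q)] with t h h1 h2
  rw [h, Pi.add_apply, h1, h2, Pi.add_apply]

theorem W12.rep_smul (c : ℝ) (p : W12 n) : W12.rep (c • p) = c • (W12.rep p) := by
  refine W12.rep_eq ((W12.continuous_rep p).const_smul c) ?_
  rw [map_smul]
  filter_upwards [Lp.coeFn_smul c (W12.incl n p), (W12.incl_ae p)] with t h h1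
  rw [h, Pi.smul_apply, h1, Pi.smul_apply]

/-- Evaluation of the continuous representative at a point. -/
@[simps]
noncomputable def W12.evalAt (t : ℝ) : W12 n →ₗ[ℝ] EuclideanSpace ℝ (Fin n) where
  toFun p := (W12.rep p) t
  map_add' p q := by rw [W12.rep_add, Pi.add_apply]
  map_smul' c p := by rw [W12.rep_smul, Pi.smul_apply, RingHom.id_apply]

theorem W12.ext_rep {p q : W12 n} (h : (W12.rep p) = (W12.rep q)) : p = q := by
  have h0 : W12.incl n p = W12.incl n q :=
    Lp.ext ((W12.incl_ae p).trans (h ▸ (W12.incl_ae q).symm))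
  refine W12.ext_incl_dt h0 (Lp.ext ?_)
  filter_upwards [(W12.isPrimitive_rep p).ae_hasDerivAt, (W12.isPrimitive_rep q).ae_hasDerivAt] with t h1 h2
  rw [h] at h1
  exact h1.unique h2

/-- Square integrable functions `F`, `f` with `F` a primitive of `f` define an element of the
Sobolev space. -/
theorem W12.exists_of_isPrimitive {F f : ℝ → EuclideanSpace ℝ (Fin n)} (h : IsPrimitive F f)
    (hF : MemLp F 2 volume) (hf : MemLp f 2 volume) :
    ∃ p : W12 n, (W12.rep p) = F ∧ W12.dt n p =ᵐ[volume] f := by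
  obtain ⟨p, h1, h2⟩ := W12.exists_of_isWeakDeriv h.isWeakDeriv hF hf
  exact ⟨p, W12.rep_eq h.continuous h1, h2⟩

/-- Hölder continuity of Sobolev functions on the line. -/
theorem W12.norm_rep_sub_le (p : W12 n) {s t : ℝ} (hst : s ≤ t) :
    ‖(W12.rep p) t - (W12.rep p) s‖ ≤ √(t - s) * ‖p‖ := by
  have hdt : ‖W12.dt n p‖ ≤ ‖p‖ := by
    have := (W12.norm_sq p)
    exact le_of_sq_le_sq (by nlinarith [sq_nonneg ‖W12.incl n p‖]) (norm_nonneg _)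
  rw [← (W12.isPrimitive_rep p).integral_eq, intervalIntegral.integral_of_le hst]
  set x := ∫ u in Set.Ioc s t, W12.dt n p u with hx
  have hfin : volume (Set.Ioc s t) ≠ ⊤ := by simp
  have hi : IntegrableOn (W12.dt n p) (Set.Ioc s t) :=
    ((locallyIntegrable_L2 (W12.dt n p)).integrableOn_isCompact isCompact_Icc).mono_set
      Set.Ioc_subset_Icc_self
  -- Pairing the derivative with the constant vector x on (s, t] reproduces ‖x‖²; Cauchy–Schwarz
  -- then bounds ‖x‖ after division by ‖x‖.
  have h1 : inner ℝ (indicatorConstLp 2 measurableSet_Ioc hfin x) (W12.dt n p) = ‖x‖ ^ 2 := by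
    rw [L2.inner_indicatorConstLp_eq_setIntegral_inner, integral_inner hi, ← hx,
      real_inner_self_eq_norm_sq]
  have h2 : ‖indicatorConstLp 2 measurableSet_Ioc hfin x‖ = ‖x‖ * √(t - s) := by
    rw [norm_indicatorConstLp (by norm_num) (by norm_num), Real.sqrt_eq_rpow]
    simp [Measure.real, hst]
  have h3 := real_inner_le_norm (indicatorConstLp 2 measurableSet_Ioc hfin x) (W12.dt n p)
  rw [h1, h2] at h3
  rcases eq_or_lt_of_le (norm_nonneg x) with h0 | h0
  · rw [← h0]; positivity
  · have : ‖x‖ ≤ √(t - s) * ‖W12.dt n p‖ := by nlinarith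
    exact this.trans (by gcongr)

/-- Integration by parts in the Sobolev space. -/
theorem W12.inner_dt_add_inner_dt (p q : W12 n) :
    inner ℝ (W12.dt n p) (W12.incl n q) + inner ℝ (W12.incl n p) (W12.dt n q) = 0 := by
  have h := (W12.isPrimitive_rep p).inner_prod (W12.isPrimitive_rep q)
  have i0 := L2.integrable_inner (𝕜 := ℝ) (W12.incl n p) (W12.incl n q)
  have i1 := L2.integrable_inner (𝕜 := ℝ) (W12.dt n p) (W12.incl n q)
  have i2 := L2.integrable_inner (𝕜 := ℝ) (W12.incl n p) (W12.dt n q)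
  have e0 : (fun t => inner ℝ (W12.incl n p t) (W12.incl n q t)) =ᵐ[volume]
      fun t => inner ℝ ((W12.rep p) t) ((W12.rep q) t) := by
    filter_upwards [(W12.incl_ae p), (W12.incl_ae q)] with t h1 h2
    rw [h1, h2]
  have e1 : (fun t => inner ℝ (W12.dt n p t) (W12.incl n q t) +
      inner ℝ (W12.incl n p t) (W12.dt n q t)) =ᵐ[volume]
      fun t => inner ℝ (W12.dt n p t) ((W12.rep q) t) + inner ℝ ((W12.rep p) t) (W12.dt n q t) := by
    filter_upwards [(W12.incl_ae p), (W12.incl_ae q)] with t h1 h2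
    rw [h1, h2]
  rw [L2.inner_def, L2.inner_def, ← integral_add i1 i2, integral_congr_ae e1]
  exact h.integral_eq_zero (i0.congr e0) ((i1.add i2).congr e1)

/-- Weak derivatives can be tested against the elements of the Sobolev space. -/
theorem isWeakDeriv_of_inner {f g : L2 n}
    (h : ∀ p : W12 n, inner ℝ (W12.dt n p) f + inner ℝ (W12.incl n p) g = 0) :
    IsWeakDeriv f g := by
  intro φ hφ hc
  have hd : Continuous (deriv φ) := hφ.continuous_deriv (by simp)
  have i1 := integrable_smul_L2 hd hc.deriv f
  have i2 := integrable_smul_L2 hφ.continuous hc g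
  rw [eq_neg_iff_add_eq_zero]
  refine ext_inner_left ℝ fun e => ?_
  have hG := isPrimitive_smul_const (hφ.of_le (by simp)) e
  obtain ⟨p, hp, hp'⟩ := W12.exists_of_isPrimitive hG
    ((hφ.continuous.smul continuous_const).memLp_of_hasCompactSupport hc.smul_right)
    ((hd.smul continuous_const).memLp_of_hasCompactSupport hc.deriv.smul_right)
  have h0 := h p
  rw [L2.inner_def, L2.inner_def] at h0
  rw [inner_zero_right, inner_add_right, ← integral_inner i1, ← integral_inner i2, ← h0]
  congr 1
  · refine integral_congr_ae ?_
    filter_upwards [hp'] with t ht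
    rw [ht, inner_smul_left, inner_smul_right]
    simp
  · refine integral_congr_ae ?_
    filter_upwards [W12.incl_ae p] with t ht
    rw [ht, hp, inner_smul_left, inner_smul_right]
    simp

/-- The Sobolev space is complete. -/
instance W12.completeSpace : CompleteSpace (W12 n) := by
  -- Integration by parts against all Sobolev functions characterizes the graph by continuous linear
  -- equations in L² ⊕ L², so it is closed.
  have e : (W12 n : Set (WithLp 2 (L2 n × L2 n))) =
      ⋂ p : W12 n, {x | inner ℝ (W12.dt n p) x.fst + inner ℝ (W12.incl n p) x.snd = 0} := by
    ext x
    simp only [Set.mem_iInter, Set.mem_ofPred_eq]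
    constructor
    · intro hx p
      exact W12.inner_dt_add_inner_dt p ⟨x, hx⟩
    · exact fun hx => isWeakDeriv_of_inner hx
  have hc : IsClosed (W12 n : Set (WithLp 2 (L2 n × L2 n))) := by
    rw [e]
    refine isClosed_iInter fun p => isClosed_eq ?_ continuous_const
    exact (continuous_const.inner (WithLp.fstL 2 ℝ (L2 n) (L2 n)).continuous).add
      (continuous_const.inner (WithLp.sndL 2 ℝ (L2 n) (L2 n)).continuous)
  exact hc.completeSpace_coe

end Sobolev

/-! ### The operators ∂ₜ + B(t) with B bounded and measurable; the constant coefficient case. -/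

section Multiplication

variable {n : ℕ}

/-- A bounded measurable path of linear maps of `ℝⁿ`. -/
structure IsMultiplier (B : ℝ → EuclideanSpace ℝ (Fin n) →L[ℝ] EuclideanSpace ℝ (Fin n)) :
    Prop where
  meas : AEStronglyMeasurable B volume
  bound : ∃ C, ∀ t, ‖B t‖ ≤ C

variable {B : ℝ → EuclideanSpace ℝ (Fin n) →L[ℝ] EuclideanSpace ℝ (Fin n)}

theorem IsMultiplier.memLp (hB : IsMultiplier B) {f : ℝ → EuclideanSpace ℝ (Fin n)}
    (hf : MemLp f 2 volume) : MemLp (fun t => B t (f t)) 2 volume := by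
  obtain ⟨C, hC⟩ := hB.bound
  refine hf.of_le_mul (c := C) ?_ (ae_of_all _ fun t => ?_)
  · exact (isBoundedBilinearMap_apply (𝕜 := ℝ)).continuous.comp_aestronglyMeasurable
      (hB.meas.prodMk hf.aestronglyMeasurable)
  · exact (B t).le_of_opNorm_le (hC t) _

/-- The operator of multiplication by a bounded measurable path of linear maps. -/
noncomputable def multOp (hB : IsMultiplier B) : L2 n →L[ℝ] L2 n :=
  LinearMap.mkContinuousOfExistsBound
    { toFun := fun f => (hB.memLp (Lp.memLp f)).toLp
      map_add' := fun f g => by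
        rw [← MemLp.toLp_add, MemLp.toLp_eq_toLp_iff]
        filter_upwards [Lp.coeFn_add f g] with t ht
        simp only [ht, Pi.add_apply, map_add]
      map_smul' := fun c f => by
        rw [RingHom.id_apply, ← MemLp.toLp_const_smul, MemLp.toLp_eq_toLp_iff]
        filter_upwards [Lp.coeFn_smul c f] with t ht
        simp only [ht, Pi.smul_apply, map_smul] }
    (by
      obtain ⟨C, hC⟩ := hB.bound
      refine ⟨C, fun f => Lp.norm_le_mul_norm_of_ae_le_mul ?_⟩
      filter_upwards [(hB.memLp (Lp.memLp f)).coeFn_toLp] with t ht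
      simp only [LinearMap.coe_mk, AddHom.coe_mk, ht]
      exact (B t).le_of_opNorm_le (hC t) _)

theorem multOp_ae (hB : IsMultiplier B) (f : L2 n) :
    multOp hB f =ᵐ[volume] fun t => B t (f t) :=
  (hB.memLp (Lp.memLp f)).coeFn_toLp

theorem IsMultiplier.neg (hB : IsMultiplier B) : IsMultiplier (fun t => -B t) :=
  ⟨hB.meas.neg, by simpa using hB.bound⟩

theorem isMultiplier_const (S : EuclideanSpace ℝ (Fin n) →L[ℝ] EuclideanSpace ℝ (Fin n)) :
    IsMultiplier fun _ => S :=
  ⟨aestronglyMeasurable_const, ‖S‖, fun _ => le_rfl⟩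

theorem multOp_symm (hB : IsMultiplier B) (hs : ∀ t, (B t).IsSymmetric) (f g : L2 n) :
    inner ℝ (multOp hB f) g = inner ℝ f (multOp hB g) := by
  rw [L2.inner_def, L2.inner_def]
  refine integral_congr_ae ?_
  filter_upwards [multOp_ae hB f, multOp_ae hB g] with t h1 h2
  rw [h1, h2]
  exact hs t _ _

theorem multOp_neg (hB : IsMultiplier B) (f : L2 n) : multOp hB.neg f = -multOp hB f := by
  refine Lp.ext ?_
  filter_upwards [multOp_ae hB f, multOp_ae hB.neg f, Lp.coeFn_neg (multOp hB f)] with t h1 h2 h3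
  rw [h2, h3, Pi.neg_apply, h1, neg_apply]

/-- The operator `∂ₜ + B(t)` for a bounded measurable path `B`. -/
noncomputable def lineOp (hB : IsMultiplier B) : W12 n →L[ℝ] L2 n :=
  W12.dt n + (multOp hB).comp (W12.incl n)

theorem lineOp_apply (hB : IsMultiplier B) (p : W12 n) :
    lineOp hB p = W12.dt n p + multOp hB (W12.incl n p) := rfl

theorem lineOp_ae (hB : IsMultiplier B) (p : W12 n) :
    lineOp hB p =ᵐ[volume] fun t => W12.dt n p t + B t (W12.rep p t) := by
  rw [lineOp_apply]
  filter_upwards [Lp.coeFn_add (W12.dt n p) (multOp hB (W12.incl n p)),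
    multOp_ae hB (W12.incl n p), W12.incl_ae p] with t h1 h2 h3
  rw [h1, Pi.add_apply, h2, h3]

theorem mem_ker_lineOp (hB : IsMultiplier B) (p : W12 n) :
    p ∈ (lineOp hB).ker ↔ W12.dt n p = -multOp hB (W12.incl n p) := by
  rw [LinearMap.mem_ker]
  exact add_eq_zero_iff_eq_neg

/-- The orthogonal complement of the range of `∂ₜ + B(t)`, `B` symmetric, is the kernel of
`∂ₜ - B(t)`. -/
theorem orthogonal_range_lineOp (hB : IsMultiplier B) (hs : ∀ t, (B t).IsSymmetric) :
    ((lineOp hB).range)ᗮ = (lineOp hB.neg).ker.map (W12.incl n).toLinearMap := by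
  ext g
  rw [Submodule.mem_orthogonal]
  constructor
  · intro h
    -- Orthogonality to p' + Bp for all p reads ⟨p', g⟩ + ⟨p, Bg⟩ = 0, which says that g has weak
    -- derivative Bg. So g gains Sobolev regularity automatically.
    have hw : IsWeakDeriv g (multOp hB g) := isWeakDeriv_of_inner fun p => by
      rw [← multOp_symm hB hs, ← inner_add_left]
      exact h _ ⟨p, rfl⟩
    refine ⟨⟨WithLp.toLp 2 (g, multOp hB g), hw⟩, ?_, rfl⟩
    change _ ∈ (lineOp hB.neg).ker
    rw [mem_ker_lineOp, multOp_neg hB, neg_neg]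
    rfl
  · rintro ⟨q, hq, rfl⟩ _ ⟨p, rfl⟩
    have hq' : q ∈ (lineOp hB.neg).ker := hq
    rw [mem_ker_lineOp, multOp_neg hB, neg_neg] at hq'
    have := W12.inner_dt_add_inner_dt p q
    rw [hq', ← multOp_symm hB hs, ← inner_add_left] at this
    exact this

theorem finrank_orthogonal_range_lineOp (hB : IsMultiplier B) (hs : ∀ t, (B t).IsSymmetric) :
    Module.finrank ℝ ((lineOp hB).range)ᗮ = Module.finrank ℝ (lineOp hB.neg).ker := by
  rw [orthogonal_range_lineOp hB hs]
  refine (LinearEquiv.finrank_eq (Submodule.equivMapOfInjective _ ?_ _)).symm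
  intro p q h
  exact W12.ext_rep (W12.rep_eq (W12.continuous_rep q) (by
    rw [show W12.incl n p = W12.incl n q from h]; exact W12.incl_ae q))

variable {S : EuclideanSpace ℝ (Fin n) →L[ℝ] EuclideanSpace ℝ (Fin n)}

/-- The cross term vanishes: integration by parts gives ⟨p', Sp⟩ + ⟨p, Sp'⟩ = 0, and the two
summands are equal by symmetry of S. -/
theorem norm_sq_lineOp_const (hS : S.IsSymmetric) (p : W12 n) :
    ‖lineOp (isMultiplier_const S) p‖ ^ 2 =
      ‖W12.dt n p‖ ^ 2 + ‖multOp (isMultiplier_const S) (W12.incl n p)‖ ^ 2 := by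
  have hm := isMultiplier_const S
  obtain ⟨q, hq, hq'⟩ := W12.exists_of_isPrimitive ((W12.isPrimitive_rep p).clm_comp S)
    (hm.memLp (W12.memLp_rep p)) (hm.memLp (Lp.memLp (W12.dt n p)))
  have e1 : W12.incl n q = multOp hm (W12.incl n p) := Lp.ext (by
    filter_upwards [W12.incl_ae q, W12.incl_ae p, multOp_ae hm (W12.incl n p)] with t h1 h2 h3
    rw [h1, h3, h2, hq])
  have e2 : W12.dt n q = multOp hm (W12.dt n p) :=
    Lp.ext (hq'.trans (multOp_ae hm (W12.dt n p)).symm)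
  have h := W12.inner_dt_add_inner_dt p q
  rw [e1, e2] at h
  rw [lineOp_apply, norm_add_sq_real]
  have h2 := real_inner_comm (W12.dt n p) (multOp hm (W12.incl n p))
  have h3 := multOp_symm hm (fun _ => hS) (W12.incl n p) (W12.dt n p)
  linarith

/-- The norm identity bounds the operator from below, which gives injectivity and closed range. The
same bound for -S shows that the orthogonal complement of the range is zero. -/
theorem bijective_lineOp_const (hS : S.IsSymmetric) {c : ℝ} (hc : 0 < c)
    (hb : ∀ x, c * ‖x‖ ≤ ‖S x‖) :
    Function.Bijective (lineOp (isMultiplier_const S)) := by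
  have key : ∀ S' : EuclideanSpace ℝ (Fin n) →L[ℝ] EuclideanSpace ℝ (Fin n), S'.IsSymmetric →
      (∀ x, c * ‖x‖ ≤ ‖S' x‖) → ∀ p, min 1 c * ‖p‖ ≤ ‖lineOp (isMultiplier_const S') p‖ := by
    intro S' hS' hb' p
    have hm := isMultiplier_const S'
    have h1 : c * ‖W12.incl n p‖ ≤ ‖multOp hm (W12.incl n p)‖ := by
      have : ‖c • W12.incl n p‖ ≤ ‖multOp hm (W12.incl n p)‖ := by
        refine Lp.norm_le_norm_of_ae_le ?_
        filter_upwards [Lp.coeFn_smul c (W12.incl n p), multOp_ae hm (W12.incl n p)] with t h1 h2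
        rw [h1, h2, Pi.smul_apply, norm_smul, Real.norm_of_nonneg hc.le]
        exact hb' _
      rwa [norm_smul, Real.norm_of_nonneg hc.le] at this
    refine le_of_sq_le_sq ?_ (norm_nonneg _)
    have hp := W12.norm_sq p
    have hmin : 0 < min 1 c := lt_min one_pos hc
    have m1 : (min 1 c) ^ 2 ≤ 1 := by nlinarith [min_le_left 1 c]
    have m2 : (min 1 c * ‖W12.incl n p‖) ^ 2 ≤ ‖multOp hm (W12.incl n p)‖ ^ 2 := by
      gcongr
      exact (mul_le_mul_of_nonneg_right (min_le_right 1 c) (norm_nonneg _)).trans h1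
    rw [norm_sq_lineOp_const hS', mul_pow, hp, mul_add, ← mul_pow]
    nlinarith [sq_nonneg ‖W12.dt n p‖]
  have hpos : 0 < min 1 c := lt_min one_pos hc
  have hanti : AntilipschitzWith (min 1 c)⁻¹.toNNReal (lineOp (isMultiplier_const S)) := by
    refine ContinuousLinearMap.antilipschitz_of_bound _ fun p => ?_
    rw [Real.coe_toNNReal _ (inv_nonneg.2 hpos.le), inv_mul_eq_div, le_div_iff₀ hpos, mul_comm]
    exact key S hS hb p
  refine ⟨hanti.injective, ?_⟩
  have hcl : IsClosed ((lineOp (isMultiplier_const S)).range : Set (L2 n)) := by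
    rw [LinearMap.coe_range]
    exact hanti.isClosed_range (lineOp (isMultiplier_const S)).uniformContinuous
  have : CompleteSpace (lineOp (isMultiplier_const S)).range := hcl.completeSpace_coe
  have ho : ((lineOp (isMultiplier_const S)).range)ᗮ = ⊥ := by
    rw [orthogonal_range_lineOp _ fun _ => hS, eq_bot_iff]
    rintro _ ⟨p, hp, rfl⟩
    have h0 : lineOp (isMultiplier_const (-S)) p = 0 := hp
    have := key (-S) (fun x y => by simpa using hS x y) (by simpa using hb) p
    rw [h0, norm_zero] at this
    have : ‖p‖ ≤ 0 := by nlinarith [norm_nonneg p]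
    obtain rfl : p = 0 := by simpa using this
    simp
  have := (Submodule.orthogonal_eq_bot_iff).1 ho
  exact LinearMap.range_eq_top.1 this

end Multiplication

/-! ### Spectral decomposition and dimension counts in ℝⁿ. -/

section Diagonal

variable {n : ℕ}

/-- `S` is diagonal in the orthonormal basis `b`, with the nonzero eigenvalues `w`. -/
structure IsDiagonal (S : EuclideanSpace ℝ (Fin n) →L[ℝ] EuclideanSpace ℝ (Fin n))
    (b : OrthonormalBasis (Fin n) ℝ (EuclideanSpace ℝ (Fin n))) (w : Fin n → ℝ) : Prop where
  apply : ∀ k, S (b k) = w k • b k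
  ne_zero : ∀ k, w k ≠ 0

variable {S : EuclideanSpace ℝ (Fin n) →L[ℝ] EuclideanSpace ℝ (Fin n)}
  {b : OrthonormalBasis (Fin n) ℝ (EuclideanSpace ℝ (Fin n))} {w : Fin n → ℝ}

theorem IsDiagonal.neg (h : IsDiagonal S b w) : IsDiagonal (-S) b (-w) :=
  ⟨fun k => by simp [h.apply], fun k => by simpa using h.ne_zero k⟩

theorem IsDiagonal.apply_eq_sum (h : IsDiagonal S b w) (x : EuclideanSpace ℝ (Fin n)) :
    S x = ∑ k, (w k * inner ℝ (b k) x) • b k := by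
  conv_lhs => rw [← b.sum_repr' x]
  simp [h.apply, smul_smul, mul_comm]

theorem IsDiagonal.inner_apply (h : IsDiagonal S b w) (k : Fin n) (x : EuclideanSpace ℝ (Fin n)) :
    inner ℝ (b k) (S x) = w k * inner ℝ (b k) x := by
  rw [h.apply_eq_sum, b.orthonormal.inner_right_fintype]

theorem IsDiagonal.isSymmetric (h : IsDiagonal S b w) : S.IsSymmetric := by
  intro x y
  rw [ContinuousLinearMap.coe_coe, ← b.sum_inner_mul_inner, ← b.sum_inner_mul_inner x]
  refine Finset.sum_congr rfl fun k _ => ?_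
  rw [h.inner_apply, real_inner_comm, h.inner_apply, real_inner_comm]
  ring

theorem IsDiagonal.exists_bound_below (h : IsDiagonal S b w) :
    ∃ c > 0, ∀ x, c * ‖x‖ ≤ ‖S x‖ := by
  have hk : S.ker = ⊥ := by
    rw [LinearMap.ker_eq_bot']
    intro x hx
    refine b.toBasis.ext_elem fun k => ?_
    have := h.inner_apply k x
    rw [show S x = 0 from hx, inner_zero_right, eq_comm, mul_eq_zero] at this
    simpa [b.repr_apply_apply] using this.resolve_left (h.ne_zero k)
  obtain ⟨K, hK, ha⟩ := S.toLinearMap.exists_antilipschitzWith hk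
  refine ⟨(K : ℝ)⁻¹, by positivity, fun x => ?_⟩
  have := ha.le_mul_dist x 0
  rw [dist_zero_right, map_zero, dist_zero_right] at this
  rw [inv_mul_le_iff₀ (by positivity)]
  exact this

/-- The sum of the eigenspaces for the eigenvalues that are not negative. -/
noncomputable def nonnegSpace (b : OrthonormalBasis (Fin n) ℝ (EuclideanSpace ℝ (Fin n)))
    (w : Fin n → ℝ) : Submodule ℝ (EuclideanSpace ℝ (Fin n)) where
  carrier := {x | ∀ k, w k < 0 → inner ℝ (b k) x = 0}
  zero_mem' := fun k _ => inner_zero_right _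
  add_mem' := fun hx hy k hk => by rw [inner_add_right, hx k hk, hy k hk, add_zero]
  smul_mem' := fun c x hx k hk => by rw [inner_smul_right, hx k hk, mul_zero]

theorem mem_nonnegSpace {x : EuclideanSpace ℝ (Fin n)} :
    x ∈ nonnegSpace b w ↔ ∀ k, w k < 0 → inner ℝ (b k) x = 0 := Iff.rfl

/-- Without zero eigenvalues each basis vector lies in exactly one of the two spaces; an eigenvector
for the eigenvalue 0 would lie in both. -/
theorem nonnegSpace_neg (hw : ∀ k, w k ≠ 0) : nonnegSpace b (-w) = (nonnegSpace b w)ᗮ := by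
  ext x
  rw [Submodule.mem_orthogonal]
  constructor
  · intro hx y hy
    rw [← b.sum_inner_mul_inner]
    refine Finset.sum_eq_zero fun k _ => ?_
    rcases lt_or_gt_of_ne (hw k) with h | h
    · rw [real_inner_comm, hy k h, zero_mul]
    · rw [hx k (by simpa using h), mul_zero]
  · intro hx k hk
    refine hx (b k) fun j hj => ?_
    have : j ≠ k := by
      rintro rfl
      simp at hk
      linarith
    exact b.orthonormal.2 this

theorem nonnegSpace_eq_orthogonal_span :
    nonnegSpace b w = (Submodule.span ℝ (Set.range fun k : {k // w k < 0} => b k))ᗮ := by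
  ext x
  rw [Submodule.mem_orthogonal, mem_nonnegSpace]
  constructor
  · intro hx u hu
    induction hu using Submodule.span_induction with
    | mem y hy =>
      obtain ⟨k, rfl⟩ := hy
      exact hx k k.2
    | zero => exact inner_zero_left _
    | add y z _ _ h1 h2 => rw [inner_add_left, h1, h2, add_zero]
    | smul c y _ h => rw [inner_smul_left, h, mul_zero]
  · exact fun hx k hk => hx _ (Submodule.subset_span ⟨⟨k, hk⟩, rfl⟩)

theorem finrank_nonnegSpace :
    {k | w k < 0}.ncard + Module.finrank ℝ (nonnegSpace b w) = n := by
  have h := Submodule.finrank_add_finrank_orthogonal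
    (Submodule.span ℝ (Set.range fun k : {k // w k < 0} => b k))
  have hs : Module.finrank ℝ (Submodule.span ℝ (Set.range fun k : {k // w k < 0} => b k)) =
      Fintype.card {k // w k < 0} :=
    finrank_span_eq_card (b.orthonormal.linearIndependent.comp _ Subtype.val_injective)
  rw [← nonnegSpace_eq_orthogonal_span, finrank_euclideanSpace_fin, hs] at h
  rw [← Nat.card_eq_fintype_card] at h
  exact h

/-- Since Uᗮ ⊓ Vᗮ is the orthogonal complement of U ⊔ V, the relative position of U and V cancels.
This is why the index sees only the two inertia indices. -/
theorem finrank_inf_sub_finrank_orthogonal_inf (U V : Submodule ℝ (EuclideanSpace ℝ (Fin n))) :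
    (Module.finrank ℝ (U ⊓ V : Submodule ℝ (EuclideanSpace ℝ (Fin n))) : ℤ) -
      Module.finrank ℝ (Uᗮ ⊓ Vᗮ : Submodule ℝ (EuclideanSpace ℝ (Fin n))) =
      Module.finrank ℝ U + Module.finrank ℝ V - n := by
  have h1 := Submodule.finrank_sup_add_finrank_inf_eq U V
  have h2 := Submodule.finrank_add_finrank_orthogonal (U ⊔ V)
  rw [finrank_euclideanSpace_fin, ← Submodule.inf_orthogonal] at h2
  zify at h1 h2
  linear_combination h1 - h2

/-- The negative index of inertia is the number of negative eigenvalues. -/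
theorem exists_isDiagonal (M : Matrix (Fin n) (Fin n) ℝ) (hM : M.IsSymm) (hM' : IsUnit M) :
    ∃ b w, IsDiagonal (act M) b w ∧ negInd M = {k | w k < 0}.ncard := by
  have hH : M.IsHermitian := by
    rw [Matrix.IsHermitian, Matrix.conjTranspose_eq_transpose_of_trivial]; exact hM
  have ha : ∀ k, act M (hH.eigenvectorBasis k) = hH.eigenvalues k • hH.eigenvectorBasis k := by
    intro k
    have := hH.mulVec_eigenvectorBasis k
    ext i
    exact congrFun this i
  have hd : IsDiagonal (act M) hH.eigenvectorBasis hH.eigenvalues := by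
    refine ⟨ha, fun k hk => ?_⟩
    have h0 : M.mulVec (hH.eigenvectorBasis k).ofLp = 0 := by
      have := hH.mulVec_eigenvectorBasis k
      rw [hk, zero_smul] at this
      exact this
    have : (hH.eigenvectorBasis k).ofLp = 0 := by
      apply Matrix.mulVec_injective_of_isUnit hM'
      rw [h0, Matrix.mulVec_zero]
    exact hH.eigenvectorBasis.orthonormal.ne_zero k ((WithLp.ofLp_eq_zero 2).1 this)
  refine ⟨_, _, hd, ?_⟩
  -- Eigenvector coordinates turn the form into the sum of squares weighted by the eigenvalues, from
  -- which the inertia is read off.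
  refine QuadraticForm.sigNeg_of_equiv_weightedSumSquares ⟨
    { toLinearEquiv := (WithLp.linearEquiv 2 ℝ (Fin n → ℝ)).symm.trans
        (hH.eigenvectorBasis.repr.toLinearEquiv.trans (WithLp.linearEquiv 2 ℝ (Fin n → ℝ)))
      map_app' := fun x => ?_ }⟩
  have hx : M.toQuadraticForm' x = inner ℝ (WithLp.toLp 2 x) (act M (WithLp.toLp 2 x)) := by
    rw [Matrix.toQuadraticForm', LinearMap.BilinMap.toQuadraticMap_apply,
      Matrix.toLinearMap₂'_apply', EuclideanSpace.inner_eq_star_dotProduct, dotProduct_comm]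
    rfl
  rw [hx, ← hH.eigenvectorBasis.sum_inner_mul_inner]
  simp only [hd.inner_apply]
  rw [QuadraticMap.weightedSumSquares_apply]
  refine Finset.sum_congr rfl fun k _ => ?_
  have : hH.eigenvectorBasis.repr (WithLp.toLp 2 x) k =
    inner ℝ (hH.eigenvectorBasis k) (WithLp.toLp 2 x) := hH.eigenvectorBasis.repr_apply_apply _ _
  simp only [smul_eq_mul]
  change hH.eigenvalues k * (hH.eigenvectorBasis.repr (WithLp.toLp 2 x) k *
    hH.eigenvectorBasis.repr (WithLp.toLp 2 x) k) = _
  rw [this, real_inner_comm]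
  ring

end Diagonal

/-! ### The kernel for the path that jumps at the origin. -/

section Model

variable {n : ℕ}

open Classical in
/-- Gluing of two functions at the origin. -/
noncomputable def glue {α : Type*} (f g : ℝ → α) : ℝ → α := (Set.Iio (0 : ℝ)).piecewise f g

theorem glue_of_neg {α : Type*} {f g : ℝ → α} {t : ℝ} (h : t < 0) : glue f g t = f t :=
  Set.piecewise_eq_of_mem _ _ _ h

theorem glue_of_nonneg {α : Type*} {f g : ℝ → α} {t : ℝ} (h : 0 ≤ t) : glue f g t = g t :=
  Set.piecewise_eq_of_notMem _ _ _ (by simpa using h)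

theorem memLp_glue {f g : ℝ → EuclideanSpace ℝ (Fin n)}
    (hf : MemLp f 2 (volume.restrict (Set.Iio 0))) (hg : MemLp g 2 (volume.restrict (Set.Ici 0))) :
    MemLp (glue f g) 2 volume := by
  classical
  unfold glue
  convert MemLp.piecewise measurableSet_Iio hf (by rwa [Set.compl_Iio])

theorem IsPrimitive.glue {F f G g : ℝ → EuclideanSpace ℝ (Fin n)} (hF : IsPrimitive F f)
    (hG : IsPrimitive G g) (h0 : F 0 = G 0) : IsPrimitive (glue F G) (glue f g) := by
  have hloc : LocallyIntegrable (FredholmLine.glue f g) := by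
    have e : FredholmLine.glue f g =
        (Set.Iio (0 : ℝ)).indicator f + (Set.Ici (0 : ℝ)).indicator g := by
      ext1 t
      rcases lt_or_ge t 0 with h | h
      · simp [glue_of_neg h, h]
      · simp [glue_of_nonneg h, h]
    rw [e]
    exact (hF.locInt.indicator measurableSet_Iio).add (hG.locInt.indicator measurableSet_Ici)
  have hglue_int : ∀ a b, IntervalIntegrable (FredholmLine.glue f g) volume a b := fun a b =>
    intervalIntegrable_iff.2 ((hloc.integrableOn_isCompact isCompact_uIcc).mono_set
      Set.uIoc_subset_uIcc)
  have key : ∀ t, ∫ s in (0 : ℝ)..t, FredholmLine.glue f g s = FredholmLine.glue F G t - G 0 := by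
    intro t
    rcases lt_or_ge t 0 with h | h
    · rw [glue_of_neg h, ← h0, ← hF.integral_eq]
      refine intervalIntegral.integral_congr_ae ?_
      have hne : ∀ᵐ s : ℝ, s ≠ 0 := by simp [ae_iff]
      filter_upwards [hne] with s hs hs'
      rw [Set.uIoc_of_ge h.le] at hs'
      exact glue_of_neg (lt_of_le_of_ne hs'.2 hs)
    · rw [glue_of_nonneg h, ← hG.integral_eq]
      refine intervalIntegral.integral_congr_ae (ae_of_all _ fun s hs' => ?_)
      rw [Set.uIoc_of_le h] at hs'
      exact glue_of_nonneg hs'.1.le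
  refine ⟨hloc, fun a b => ?_⟩
  rw [← intervalIntegral.integral_interval_sub_left (hglue_int 0 b) (hglue_int 0 a), key, key]
  abel

/-- A solution of the scalar equation `y' = -a y` is an exponential function. -/
theorem IsPrimitive.eq_exp {y f : ℝ → ℝ} (h : IsPrimitive y f) {a t : ℝ}
    (hf : ∀ᵐ s, s ∈ Set.uIoc 0 t → f s = -a * y s) : y t = Real.exp (-(a * t)) * y 0 := by
  have he : IsPrimitive (fun t => Real.exp (a * t)) (fun t => Real.exp (a * t) * a) := by
    have h1 := isPrimitive_of_contDiff (F := fun t : ℝ => Real.exp (a * t)) (by fun_prop)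
    have h2 : deriv (fun t : ℝ => Real.exp (a * t)) = fun t => Real.exp (a * t) * a := by
      ext t
      simpa using (((hasDerivAt_id t).const_mul a).exp).deriv
    rwa [h2] at h1
  -- The product of y with the integrating factor e^{at} has derivative zero a.e. between 0 and t.
  have h1 := (h.mul he).integral_eq 0 t
  rw [intervalIntegral.integral_zero_ae] at h1
  · simp only [mul_zero, Real.exp_zero, mul_one] at h1
    rw [Real.exp_neg, ← sub_eq_zero.1 h1.symm]
    field_simp
  · filter_upwards [hf] with s hs hs'
    rw [hs hs']
    ring

/-- Used to exclude the exponentials that do not decay on a half-line. -/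
theorem eq_zero_of_memLp_of_le {y : ℝ → ℝ} (hy : MemLp y 2 volume) {s : Set ℝ}
    (hs : MeasurableSet s) (hv : volume s = ⊤) {c : ℝ} (h : ∀ t ∈ s, |c| ≤ |y t|) : c = 0 := by
  have h1 : MemLp (fun _ : ℝ => c) 2 (volume.restrict s) :=
    (hy.restrict s).of_le aestronglyMeasurable_const ((ae_restrict_iff' hs).2 (ae_of_all _ h))
  rw [memLp_const_iff (by norm_num) (by norm_num)] at h1
  refine h1.resolve_right ?_
  simp [hv]

variable {Sm Sp : EuclideanSpace ℝ (Fin n) →L[ℝ] EuclideanSpace ℝ (Fin n)}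
  {bm bp : OrthonormalBasis (Fin n) ℝ (EuclideanSpace ℝ (Fin n))} {wm wp : Fin n → ℝ}

/-- The path that jumps from `Sm` to `Sp` at the origin. -/
noncomputable abbrev stepPath
    (Sm Sp : EuclideanSpace ℝ (Fin n) →L[ℝ] EuclideanSpace ℝ (Fin n)) :
    ℝ → EuclideanSpace ℝ (Fin n) →L[ℝ] EuclideanSpace ℝ (Fin n) :=
  glue (fun _ => Sm) (fun _ => Sp)

theorem isMultiplier_stepPath : IsMultiplier (stepPath Sm Sp) := by
  refine ⟨?_, max ‖Sm‖ ‖Sp‖, fun t => ?_⟩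
  · exact (stronglyMeasurable_const.piecewise measurableSet_Iio
      stronglyMeasurable_const).aestronglyMeasurable
  · rcases lt_or_ge t 0 with h | h
    · rw [stepPath, glue_of_neg h]; exact le_max_left _ _
    · rw [stepPath, glue_of_nonneg h]; exact le_max_right _ _

theorem coord_of_mem_ker (hm : IsDiagonal Sm bm wm) (hp : IsDiagonal Sp bp wp)
    {p : W12 n} (h : p ∈ (lineOp (isMultiplier_stepPath (Sm := Sm) (Sp := Sp))).ker) (k : Fin n) :
    (∀ t ≤ 0, inner ℝ (bm k) (W12.rep p t) =
      Real.exp (-(wm k * t)) * inner ℝ (bm k) (W12.rep p 0)) ∧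
    (∀ t, 0 ≤ t → inner ℝ (bp k) (W12.rep p t) =
      Real.exp (-(wp k * t)) * inner ℝ (bp k) (W12.rep p 0)) := by
  rw [mem_ker_lineOp] at h
  have hdt : ∀ᵐ t, W12.dt n p t = -stepPath Sm Sp t (W12.rep p t) := by
    rw [h]
    filter_upwards [Lp.coeFn_neg (multOp isMultiplier_stepPath (W12.incl n p)),
      multOp_ae (isMultiplier_stepPath (Sm := Sm) (Sp := Sp)) (W12.incl n p),
      W12.incl_ae p] with t h1 h2 h3
    rw [h1, Pi.neg_apply, h2, h3]
  have hne : ∀ᵐ s : ℝ, s ≠ 0 := by simp [ae_iff]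
  constructor
  · intro t ht
    refine ((W12.isPrimitive_rep p).clm_comp (innerSL ℝ (bm k))).eq_exp ?_
    filter_upwards [hdt, hne] with s h1 h2 hs
    rw [Set.uIoc_of_ge ht] at hs
    rw [h1, stepPath, glue_of_neg (lt_of_le_of_ne hs.2 h2)]
    simp [hm.inner_apply]
  · intro t ht
    refine ((W12.isPrimitive_rep p).clm_comp (innerSL ℝ (bp k))).eq_exp ?_
    filter_upwards [hdt] with s h1 hs
    rw [Set.uIoc_of_le ht] at hs
    rw [h1, stepPath, glue_of_nonneg hs.1.le]
    simp [hp.inner_apply]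

/-- The factor e^{-wt} is at least 1 for t ≥ 0 when w < 0, and for t ≤ 0 when w > 0. Square
integrability kills these coordinates at +∞ and at -∞ respectively. -/
theorem rep_zero_mem_of_mem_ker (hm : IsDiagonal Sm bm wm) (hp : IsDiagonal Sp bp wp)
    {p : W12 n} (h : p ∈ (lineOp (isMultiplier_stepPath (Sm := Sm) (Sp := Sp))).ker) :
    W12.rep p 0 ∈ nonnegSpace bp wp ⊓ nonnegSpace bm (-wm) := by
  refine ⟨fun k hk => ?_, fun k hk => ?_⟩
  · refine eq_zero_of_memLp_of_le ((W12.memLp_rep p).const_inner (bp k)) (s := Set.Ici 0)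
      measurableSet_Ici Real.volume_Ici fun t ht => ?_
    rw [(coord_of_mem_ker hm hp h k).2 t ht, abs_mul, Real.abs_exp]
    refine le_mul_of_one_le_left (abs_nonneg _) (Real.one_le_exp ?_)
    have : 0 ≤ t := ht
    nlinarith
  · refine eq_zero_of_memLp_of_le ((W12.memLp_rep p).const_inner (bm k)) (s := Set.Iic 0)
      measurableSet_Iic Real.volume_Iic fun t ht => ?_
    rw [(coord_of_mem_ker hm hp h k).1 t ht, abs_mul, Real.abs_exp]
    refine le_mul_of_one_le_left (abs_nonneg _) (Real.one_le_exp ?_)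
    have : t ≤ 0 := ht
    have : -wm k < 0 := hk
    nlinarith

/-- The solution of `x' = -S x` with initial value `x`, in terms of the eigenvectors of `S`. -/
noncomputable def expFlow (b : OrthonormalBasis (Fin n) ℝ (EuclideanSpace ℝ (Fin n)))
    (w : Fin n → ℝ) (x : EuclideanSpace ℝ (Fin n)) (t : ℝ) : EuclideanSpace ℝ (Fin n) :=
  ∑ k, (Real.exp (-(w k * t)) * inner ℝ (b k) x) • b k

theorem expFlow_zero (b : OrthonormalBasis (Fin n) ℝ (EuclideanSpace ℝ (Fin n)))
    (w : Fin n → ℝ) (x : EuclideanSpace ℝ (Fin n)) : expFlow b w x 0 = x := by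
  simp [expFlow, b.sum_repr']

theorem isPrimitive_expFlow {S : EuclideanSpace ℝ (Fin n) →L[ℝ] EuclideanSpace ℝ (Fin n)}
    {b : OrthonormalBasis (Fin n) ℝ (EuclideanSpace ℝ (Fin n))} {w : Fin n → ℝ}
    (h : IsDiagonal S b w) (x : EuclideanSpace ℝ (Fin n)) :
    IsPrimitive (expFlow b w x) (fun t => -S (expFlow b w x t)) := by
  have h1 := isPrimitive_of_contDiff (F := expFlow b w x) (by unfold expFlow; fun_prop)
  have h2 : deriv (expFlow b w x) = fun t => -S (expFlow b w x t) := by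
    ext1 t
    have hd : HasDerivAt (expFlow b w x) (∑ k, (Real.exp (-(w k * t)) * (-(w k * 1)) *
        inner ℝ (b k) x) • b k) t := by
      unfold expFlow
      refine HasDerivAt.fun_sum fun k _ => ?_
      exact ((((hasDerivAt_id t).const_mul (w k)).neg.exp).mul_const _).smul_const _
    rw [hd.deriv, expFlow, map_sum, ← Finset.sum_neg_distrib]
    refine Finset.sum_congr rfl fun k _ => ?_
    rw [map_smul, h.apply, smul_smul, ← neg_smul]
    congr 1
    ring
  rwa [h2] at h1

theorem memLp_expFlow {b : OrthonormalBasis (Fin n) ℝ (EuclideanSpace ℝ (Fin n))} {w : Fin n → ℝ}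
    {x : EuclideanSpace ℝ (Fin n)} {s : Set ℝ}
    (h : ∀ k, inner ℝ (b k) x = 0 ∨ IntegrableOn (fun t => Real.exp (-(2 * w k) * t)) s) :
    MemLp (expFlow b w x) 2 (volume.restrict s) := by
  refine memLp_finsetSum _ fun k _ => ?_
  rcases h k with h | h
  · simp [h]
  · have he : MemLp (fun t => Real.exp (-(w k * t))) 2 (volume.restrict s) := by
      rw [memLp_two_iff_integrable_sq (by fun_prop)]
      refine h.congr (ae_of_all _ fun t => ?_)
      simp only
      rw [← Real.exp_nat_mul]
      congr 1
      push_cast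
      ring
    have : (fun t => (Real.exp (-(w k * t)) * inner ℝ (b k) x) • b k) =
        fun t => Real.exp (-(w k * t)) • (inner ℝ (b k) x • b k) := by
      ext1 t; rw [mul_smul]
    rw [this]
    exact (ContinuousLinearMap.toSpanSingleton ℝ (inner ℝ (b k) x • b k)).comp_memLp' he

/-- Glue the two exponential flows that start from x: by the choice of x only the modes that decay
on the relevant half-line occur. -/
theorem exists_mem_ker (hm : IsDiagonal Sm bm wm) (hp : IsDiagonal Sp bp wp)
    {x : EuclideanSpace ℝ (Fin n)} (hx : x ∈ nonnegSpace bp wp ⊓ nonnegSpace bm (-wm)) :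
    ∃ p ∈ (lineOp (isMultiplier_stepPath (Sm := Sm) (Sp := Sp))).ker, W12.rep p 0 = x := by
  have hF := (isPrimitive_expFlow hm x).glue (isPrimitive_expFlow hp x)
    (by rw [expFlow_zero, expFlow_zero])
  have e : glue (fun t => -Sm (expFlow bm wm x t)) (fun t => -Sp (expFlow bp wp x t)) =
      fun t => -stepPath Sm Sp t (glue (expFlow bm wm x) (expFlow bp wp x) t) := by
    ext1 t
    rcases lt_or_ge t 0 with h | h
    · simp only [stepPath, glue_of_neg h]
    · simp only [stepPath, glue_of_nonneg h]
  rw [e] at hF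
  have hL : MemLp (glue (expFlow bm wm x) (expFlow bp wp x)) 2 volume := by
    refine memLp_glue (memLp_expFlow fun k => ?_) (memLp_expFlow fun k => ?_)
    · rcases lt_or_gt_of_ne (hm.ne_zero k) with h | h
      · exact Or.inr ((integrableOn_exp_mul_Iic (by linarith) 0).mono_set Set.Iio_subset_Iic_self)
      · exact Or.inl (hx.2 k (by simpa using h))
    · rcases lt_or_gt_of_ne (hp.ne_zero k) with h | h
      · exact Or.inl (hx.1 k h)
      · refine Or.inr ?_
        rw [integrableOn_Ici_iff_integrableOn_Ioi]
        exact integrableOn_exp_mul_Ioi (by linarith) 0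
  obtain ⟨p, h1, h2⟩ := W12.exists_of_isPrimitive hF hL
    ((isMultiplier_stepPath (Sm := Sm) (Sp := Sp)).memLp hL).neg
  refine ⟨p, ?_, ?_⟩
  · rw [LinearMap.mem_ker]
    refine Lp.ext ?_
    filter_upwards [lineOp_ae (isMultiplier_stepPath (Sm := Sm) (Sp := Sp)) p, h2,
      Lp.coeFn_zero (EuclideanSpace ℝ (Fin n)) 2 (volume : Measure ℝ)] with t h3 h4 h5
    rw [h5, Pi.zero_apply]
    refine h3.trans ?_
    rw [h4, h1, neg_add_cancel]
  · rw [h1, glue_of_nonneg le_rfl, expFlow_zero]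

/-- The kernel of the model operator. -/
noncomputable def kerModelEquiv (hm : IsDiagonal Sm bm wm) (hp : IsDiagonal Sp bp wp) :
    (lineOp (isMultiplier_stepPath (Sm := Sm) (Sp := Sp))).ker ≃ₗ[ℝ]
      (nonnegSpace bp wp ⊓ nonnegSpace bm (-wm) : Submodule ℝ (EuclideanSpace ℝ (Fin n))) := by
  refine LinearEquiv.ofBijective
    ((W12.evalAt (n := n) 0).restrict fun p hq => rep_zero_mem_of_mem_ker hm hp hq) ⟨?_, ?_⟩
  · rw [← LinearMap.ker_eq_bot, LinearMap.ker_eq_bot']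
    rintro ⟨p, hq⟩ h0
    have h0 : W12.rep p 0 = 0 := congrArg Subtype.val h0
    refine Subtype.ext (W12.ext_rep (q := (0 : W12 n)) ?_)
    have hz : W12.rep (0 : W12 n) = 0 := by simpa using W12.rep_smul 0 (0 : W12 n)
    rw [hz]
    ext1 t
    rcases le_total t 0 with h | h
    · refine bm.toBasis.ext_elem fun k => ?_
      have := (coord_of_mem_ker hm hp hq k).1 t h
      simpa [bm.repr_apply_apply, h0] using this
    · refine bp.toBasis.ext_elem fun k => ?_
      have := (coord_of_mem_ker hm hp hq k).2 t h
      simpa [bp.repr_apply_apply, h0] using this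
  · rintro ⟨x, hx⟩
    obtain ⟨p, h1, h2⟩ := exists_mem_ker hm hp hx
    exact ⟨⟨p, h1⟩, Subtype.ext h2⟩

end Model

/-! ### Fredholm property and index of the model operator. -/

section ModelIndex

variable {n : ℕ} {Sm Sp : EuclideanSpace ℝ (Fin n) →L[ℝ] EuclideanSpace ℝ (Fin n)}
  {bm bp : OrthonormalBasis (Fin n) ℝ (EuclideanSpace ℝ (Fin n))} {wm wp : Fin n → ℝ}

theorem isFredholm_model (hm : IsDiagonal Sm bm wm) (hp : IsDiagonal Sp bp wp) :
    (lineOp (isMultiplier_stepPath (Sm := Sm) (Sp := Sp))).IsFredholm := by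
  obtain ⟨cm, hcm, hbm⟩ := hm.exists_bound_below
  obtain ⟨cp, hcp, hbp⟩ := hp.exists_bound_below
  let Gm := LinearEquiv.ofBijective (lineOp (isMultiplier_const Sm)).toLinearMap
    (bijective_lineOp_const hm.isSymmetric hcm hbm)
  let Gp := LinearEquiv.ofBijective (lineOp (isMultiplier_const Sp)).toLinearMap
    (bijective_lineOp_const hp.isSymmetric hcp hbp)
  -- For a right-hand side η, this is the difference at 0 of the solutions of the two constant
  -- coefficient equations. If it vanishes, the glued solution solves the step equation, so the
  -- range contains the kernel of a map to ℝⁿ.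
  let jump : L2 n →ₗ[ℝ] EuclideanSpace ℝ (Fin n) :=
    W12.evalAt 0 ∘ₗ Gm.symm.toLinearMap - W12.evalAt 0 ∘ₗ Gp.symm.toLinearMap
  have : FiniteDimensional ℝ (lineOp (isMultiplier_stepPath (Sm := Sm) (Sp := Sp))).ker :=
    Module.Finite.equiv (kerModelEquiv hm hp).symm
  have : FiniteDimensional ℝ
      (L2 n ⧸ (lineOp (isMultiplier_stepPath (Sm := Sm) (Sp := Sp))).range) := by
    refine Submodule.CoFG.of_le (S := jump.ker) (fun η hη => ?_) (Submodule.CoFG.ker jump)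
    have h0 : W12.rep (Gm.symm η) 0 = W12.rep (Gp.symm η) 0 := sub_eq_zero.1 hη
    have hm1 : lineOp (isMultiplier_const Sm) (Gm.symm η) = η := Gm.apply_symm_apply η
    have hp1 : lineOp (isMultiplier_const Sp) (Gp.symm η) = η := Gp.apply_symm_apply η
    obtain ⟨r, h1, h2⟩ := W12.exists_of_isPrimitive
      ((W12.isPrimitive_rep (Gm.symm η)).glue (W12.isPrimitive_rep (Gp.symm η)) h0)
      (memLp_glue ((W12.memLp_rep _).restrict _) ((W12.memLp_rep _).restrict _))
      (memLp_glue ((Lp.memLp _).restrict _) ((Lp.memLp _).restrict _))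
    refine ⟨r, Lp.ext ?_⟩
    have e1 := lineOp_ae (isMultiplier_const Sm) (Gm.symm η)
    have e2 := lineOp_ae (isMultiplier_const Sp) (Gp.symm η)
    rw [hm1] at e1
    rw [hp1] at e2
    filter_upwards [lineOp_ae (isMultiplier_stepPath (Sm := Sm) (Sp := Sp)) r, h2, e1, e2]
      with t a1 a2 a3 a4
    refine a1.trans ?_
    rw [a2, h1]
    rcases lt_or_ge t 0 with h | h
    · simp only [stepPath, glue_of_neg h, a3]
    · simp only [stepPath, glue_of_nonneg h, a4]
  exact isFredholm_of_finite _

theorem lineOp_congr {B B' : ℝ → EuclideanSpace ℝ (Fin n) →L[ℝ] EuclideanSpace ℝ (Fin n)}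
    (h : B = B') (hB : IsMultiplier B) (hB' : IsMultiplier B') : lineOp hB = lineOp hB' := by
  subst h; rfl

theorem fredholmIndex_model (hm : IsDiagonal Sm bm wm) (hp : IsDiagonal Sp bp wp) :
    fredholmIndex (lineOp (isMultiplier_stepPath (Sm := Sm) (Sp := Sp))) =
      ({k | wm k < 0}.ncard : ℤ) - ({k | wp k < 0}.ncard : ℤ) := by
  have hF := isFredholm_model hm hp
  have hB := isMultiplier_stepPath (Sm := Sm) (Sp := Sp)
  have hs : ∀ t, (stepPath Sm Sp t).IsSymmetric := by
    intro t
    rcases lt_or_ge t 0 with h | h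
    · rw [stepPath, glue_of_neg h]; exact hm.isSymmetric
    · rw [stepPath, glue_of_nonneg h]; exact hp.isSymmetric
  have hneg : (fun t => -stepPath Sm Sp t) = stepPath (-Sm) (-Sp) := by
    ext1 t
    rcases lt_or_ge t 0 with h | h
    · simp only [stepPath, glue_of_neg h]
    · simp only [stepPath, glue_of_nonneg h]
  have hcl := hF.isClosed_range
  have : CompleteSpace (lineOp hB).range := hcl.completeSpace_coe
  have h1 : Module.finrank ℝ (L2 n ⧸ (lineOp hB).range) = Module.finrank ℝ (lineOp hB.neg).ker := by
    rw [← finrank_orthogonal_range_lineOp hB hs]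
    exact (Submodule.quotientEquivOfIsCompl _ _
      (Submodule.isCompl_orthogonal _)).finrank_eq
  have h2 := (kerModelEquiv hm hp).finrank_eq
  have h3 := (kerModelEquiv hm.neg hp.neg).finrank_eq
  have hwm : ∀ k, (-wm) k ≠ 0 := fun k => by simpa using hm.ne_zero k
  -- With U = `nonnegSpace bp wp` and V = `nonnegSpace bm (-wm)`, the kernel is U ⊓ V and the
  -- cokernel has the dimension of Uᗮ ⊓ Vᗮ.
  rw [nonnegSpace_neg hp.ne_zero, nonnegSpace_neg hwm] at h3
  rw [lineOp_congr hneg hB.neg isMultiplier_stepPath, h3] at h1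
  have h4 := finrank_inf_sub_finrank_orthogonal_inf (nonnegSpace bp wp) (nonnegSpace bm (-wm))
  have h5 := finrank_nonnegSpace (b := bp) (w := wp)
  have h6 := finrank_nonnegSpace (b := bm) (w := wm)
  have h7 := Submodule.finrank_add_finrank_orthogonal (nonnegSpace bm wm)
  rw [← nonnegSpace_neg hm.ne_zero, finrank_euclideanSpace_fin] at h7
  rw [fredholmIndex, h1, h2]
  zify at h5 h6 h7
  linear_combination h4 + h5 - h6 + h7

end ModelIndex

/-! ### Finite rank approximation of multiplication operators on W^{1,2}. -/

section Approximation

variable {n : ℕ} {D : ℝ → EuclideanSpace ℝ (Fin n) →L[ℝ] EuclideanSpace ℝ (Fin n)}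

/-- The step function with value `c` on `[a, b)`, as a linear function of `c`. -/
noncomputable def stepLp (a b : ℝ) : EuclideanSpace ℝ (Fin n) →ₗ[ℝ] L2 n where
  toFun c := indicatorConstLp 2 (measurableSet_Ico (a := a) (b := b)) (by simp) c
  map_add' c d := by
    refine Lp.ext ?_
    filter_upwards [indicatorConstLp_coeFn (p := 2) (μ := volume) (c := c + d)
        (hs := measurableSet_Ico (a := a) (b := b)) (hμs := by simp),
      indicatorConstLp_coeFn (p := 2) (μ := volume) (c := c)
        (hs := measurableSet_Ico (a := a) (b := b)) (hμs := by simp),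
      indicatorConstLp_coeFn (p := 2) (μ := volume) (c := d)
        (hs := measurableSet_Ico (a := a) (b := b)) (hμs := by simp),
      Lp.coeFn_add (indicatorConstLp 2 (measurableSet_Ico (a := a) (b := b)) (by simp) c)
        (indicatorConstLp 2 (measurableSet_Ico (a := a) (b := b)) (by simp) d)] with t h1 h2 h3 h4
    rw [h1, h4, Pi.add_apply, h2, h3]
    by_cases h : t ∈ Set.Ico a b <;> simp [h]
  map_smul' r c := by
    refine Lp.ext ?_
    filter_upwards [indicatorConstLp_coeFn (p := 2) (μ := volume) (c := r • c)
        (hs := measurableSet_Ico (a := a) (b := b)) (hμs := by simp),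
      indicatorConstLp_coeFn (p := 2) (μ := volume) (c := c)
        (hs := measurableSet_Ico (a := a) (b := b)) (hμs := by simp),
      Lp.coeFn_smul r (indicatorConstLp 2 (measurableSet_Ico (a := a) (b := b)) (by simp) c)]
      with t h1 h2 h4
    rw [h1, RingHom.id_apply, h4, Pi.smul_apply, h2]
    by_cases h : t ∈ Set.Ico a b <;> simp [h]

theorem stepLp_ae (a b : ℝ) (c : EuclideanSpace ℝ (Fin n)) :
    stepLp a b c =ᵐ[volume] (Set.Ico a b).indicator fun _ => c :=
  indicatorConstLp_coeFn (hs := measurableSet_Ico) (hμs := by simp)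

/-- Sampling a Sobolev function on the grid with `N` points per unit length inside `[-R, R)`. -/
noncomputable def sample (R N : ℕ) : W12 n →ₗ[ℝ] L2 n :=
  ∑ k ∈ Finset.Ico (-(R * N : ℤ)) (R * N),
    stepLp ((k : ℝ) / N) ((k + 1 : ℝ) / N) ∘ₗ W12.evalAt ((k : ℝ) / N)

theorem sample_ae {R N : ℕ} (hN : 0 < N) (p : W12 n) :
    sample R N p =ᵐ[volume] (Set.Ico (-(R : ℝ)) R).indicator
      fun t => W12.rep p (⌊t * N⌋ / N) := by
  have hNr : (0 : ℝ) < N := by exact_mod_cast hN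
  have h1 : ∀ᵐ t, ∀ k : ℤ, stepLp ((k : ℝ) / N) ((k + 1 : ℝ) / N) (W12.rep p ((k : ℝ) / N)) t =
      (Set.Ico ((k : ℝ) / N) ((k + 1 : ℝ) / N)).indicator (fun _ => W12.rep p ((k : ℝ) / N)) t :=
    ae_all_iff.2 fun k => stepLp_ae _ _ _
  have h2 : sample R N p =ᵐ[volume] fun t => ∑ k ∈ Finset.Ico (-(R * N : ℤ)) (R * N),
      stepLp ((k : ℝ) / N) ((k + 1 : ℝ) / N) (W12.rep p ((k : ℝ) / N)) t := by
    have : sample R N p = ∑ k ∈ Finset.Ico (-(R * N : ℤ)) (R * N),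
      stepLp ((k : ℝ) / N) ((k + 1 : ℝ) / N) (W12.rep p ((k : ℝ) / N)) := by
      simp [sample]
    rw [this]
    refine (Lp.coeFn_finsetSum _ _).trans (ae_of_all _ fun t => ?_)
    simp
  filter_upwards [h1, h2] with t h1 h2
  rw [h2, Finset.sum_congr rfl fun k _ => h1 k]
  have hmem : ∀ k : ℤ, t ∈ Set.Ico ((k : ℝ) / N) ((k + 1 : ℝ) / N) ↔ ⌊t * N⌋ = k := fun k => by
    rw [Int.floor_eq_iff, Set.mem_Ico, div_le_iff₀ hNr, lt_div_iff₀ hNr]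
  have hreg : t ∈ Set.Ico (-(R : ℝ)) R ↔ ⌊t * N⌋ ∈ Finset.Ico (-(R * N : ℤ)) (R * N) := by
    rw [Finset.mem_Ico, Int.le_floor, Int.floor_lt, Set.mem_Ico]
    push_cast
    rw [← neg_mul, mul_le_mul_iff_left₀ hNr, mul_lt_mul_iff_left₀ hNr]
  by_cases h : t ∈ Set.Ico (-(R : ℝ)) R
  · rw [Set.indicator_of_mem h, Finset.sum_eq_single_of_mem _ (hreg.1 h) fun k _ hk =>
      Set.indicator_of_notMem (fun h' => hk ((hmem k).1 h').symm) _,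
      Set.indicator_of_mem ((hmem _).2 rfl)]
  · rw [Set.indicator_of_notMem h]
    refine Finset.sum_eq_zero fun k hk => Set.indicator_of_notMem (fun h' => h (hreg.2 ?_)) _
    rwa [(hmem k).1 h']

/-- Each of the finitely many summands factors through a point evaluation with values in ℝⁿ. -/
theorem hasFiniteRange_sample (R N : ℕ) : (sample R N : W12 n →ₗ[ℝ] L2 n).HasFiniteRange := by
  unfold sample
  refine Finset.sum_induction _ (fun f : W12 n →ₗ[ℝ] L2 n => f.HasFiniteRange)
    (fun _ _ h1 h2 => h1.add h2) LinearMap.HasFiniteRange.zero fun k _ => ?_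
  exact LinearMap.HasFiniteRange.comp_left LinearMap.HasFiniteRange.of_isNoetherian_rng _

/-- Multiplication by a path that vanishes at infinity is, on the Sobolev space, a limit of finite
rank maps. -/
theorem exists_finiteRange_approx (hD : IsMultiplier D)
    (hv : ∀ ε > 0, ∃ R : ℕ, ∀ t, (R : ℝ) ≤ |t| → ‖D t‖ ≤ ε) {ε : ℝ} (hε : 0 < ε) :
    ∃ F : W12 n →ₗ[ℝ] L2 n, F.HasFiniteRange ∧
      ∀ p, ‖multOp hD (W12.incl n p) - F p‖ ≤ ε * ‖p‖ := by
  obtain ⟨R, hR⟩ := hv (ε / 2) (by positivity)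
  obtain ⟨C, hC⟩ := hD.bound
  have hC0 : 0 ≤ C := (norm_nonneg _).trans (hC 0)
  -- On a grid of mesh 1/(N + 1) the sampling error is at most √(1/(N + 1))‖p‖ pointwise; C bounds
  -- D, and √(2R) is the L² norm of the indicator of [-R, R).
  obtain ⟨N, hN⟩ : ∃ N : ℕ, C * √(1 / (N + 1 : ℝ)) * √(2 * R) ≤ ε / 2 := by
    have h1 : Tendsto (fun N : ℕ => C * √(1 / (N + 1 : ℝ)) * √(2 * R)) atTop
        (𝓝 (C * √0 * √(2 * R))) :=
      ((tendsto_one_div_add_atTop_nhds_zero_nat.sqrt).const_mul C).mul_const _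
    rw [Real.sqrt_zero, mul_zero, zero_mul] at h1
    exact (h1.eventually_le_const (by positivity)).exists
  refine ⟨(multOp hD).toLinearMap ∘ₗ sample R (N + 1),
    (hasFiniteRange_sample R (N + 1)).comp_left _, fun p => ?_⟩
  have hfin : volume (Set.Ico (-(R : ℝ)) R) ≠ ⊤ := by simp
  set c : ℝ := C * √(1 / (N + 1 : ℝ)) * ‖p‖ with hc
  have hc0 : 0 ≤ c := by positivity
  let G₁ : Lp ℝ 2 (volume : Measure ℝ) := (Lp.memLp (W12.incl n p)).norm.toLp
  let G₂ : Lp ℝ 2 (volume : Measure ℝ) := indicatorConstLp 2 measurableSet_Ico hfin c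
  have hG₁ : ‖G₁‖ ≤ ‖p‖ := by
    have h1 : ‖G₁‖ = ‖W12.incl n p‖ := by
      rw [Lp.norm_toLp, eLpNorm_norm, Lp.norm_def]
    rw [h1]
    have := W12.norm_sq p
    exact le_of_sq_le_sq (by nlinarith [sq_nonneg ‖W12.dt n p‖]) (norm_nonneg _)
  have hG₂ : ‖G₂‖ = c * √(2 * R) := by
    rw [norm_indicatorConstLp (by norm_num) (by norm_num), Real.norm_of_nonneg hc0,
      Real.sqrt_eq_rpow]
    congr 1
    simp only [Measure.real, Real.volume_Ico, ENNReal.toReal_ofNat]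
    rw [ENNReal.toReal_ofReal (by linarith [Nat.cast_nonneg (α := ℝ) R])]
    congr 1
    ring
  -- The error is dominated pointwise: by c inside [-R, R), through the Hölder bound, and by
  -- (ε/2)|p| outside, where the sample is zero and D is small.
  have hle : ‖multOp hD (W12.incl n p) - multOp hD (sample R (N + 1) p)‖ ≤
      ‖(ε / 2) • G₁ + G₂‖ := by
    rw [← map_sub]
    refine Lp.norm_le_norm_of_ae_le ?_
    filter_upwards [multOp_ae hD (W12.incl n p - sample R (N + 1) p),
      Lp.coeFn_sub (W12.incl n p) (sample R (N + 1) p), sample_ae (R := R) N.succ_pos p,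
      W12.incl_ae p, Lp.coeFn_add ((ε / 2) • G₁) G₂, Lp.coeFn_smul (ε / 2) G₁,
      (Lp.memLp (W12.incl n p)).norm.coeFn_toLp,
      indicatorConstLp_coeFn (p := 2) (hs := measurableSet_Ico) (hμs := hfin) (c := c)]
      with t a1 a2 a3 a4 a5 a6 a7 a8
    rw [a1, a2, a5, Pi.sub_apply, a3, Pi.add_apply, a6, Pi.smul_apply]
    have a7' : G₁ t = ‖W12.incl n p t‖ := a7
    have a8' : G₂ t = (Set.Ico (-(R : ℝ)) R).indicator (fun _ => c) t := a8
    rw [a7', a8', a4]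
    by_cases h : t ∈ Set.Ico (-(R : ℝ)) R
    · rw [Set.indicator_of_mem h, Set.indicator_of_mem h, Real.norm_of_nonneg (by positivity)]
      have hNr : (0 : ℝ) < ((N + 1 : ℕ) : ℝ) := by positivity
      have b1 : (⌊t * (N + 1 : ℕ)⌋ : ℝ) / (N + 1 : ℕ) ≤ t := by
        rw [div_le_iff₀ hNr]; exact Int.floor_le _
      have b2 : t - (⌊t * (N + 1 : ℕ)⌋ : ℝ) / (N + 1 : ℕ) ≤ 1 / (N + 1 : ℝ) := by
        have := Int.lt_floor_add_one (t * (N + 1 : ℕ))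
        rw [sub_le_iff_le_add, show (1 : ℝ) / (N + 1 : ℝ) = 1 / (N + 1 : ℕ) by push_cast; rfl,
          ← add_div, le_div_iff₀ hNr]
        linarith
      calc ‖D t (W12.rep p t - W12.rep p (⌊t * (N + 1 : ℕ)⌋ / (N + 1 : ℕ)))‖
          ≤ C * (√(t - ⌊t * (N + 1 : ℕ)⌋ / (N + 1 : ℕ)) * ‖p‖) :=
            (D t).le_of_opNorm_le_of_le (hC t) (W12.norm_rep_sub_le p b1)
        _ ≤ C * (√(1 / (N + 1 : ℝ)) * ‖p‖) := by gcongr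
        _ = c := by rw [hc]; ring
        _ ≤ _ := le_add_of_nonneg_left (by positivity)
    · rw [Set.indicator_of_notMem h, Set.indicator_of_notMem h, sub_zero, add_zero, norm_smul,
        Real.norm_of_nonneg (by positivity), norm_norm]
      refine (D t).le_of_opNorm_le (hR t ?_) _
      rw [Set.mem_Ico, not_and_or, not_le, not_lt] at h
      rw [le_abs]
      rcases h with h | h
      · exact Or.inr (by linarith)
      · exact Or.inl h
  refine hle.trans ((norm_add_le _ _).trans ?_)
  rw [norm_smul, Real.norm_of_nonneg (by positivity), hG₂]
  have h1 : ε / 2 * ‖G₁‖ ≤ ε / 2 * ‖p‖ := by gcongr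
  have h2 : c * √(2 * R) ≤ ε / 2 * ‖p‖ :=
    calc c * √(2 * R) = C * √(1 / (N + 1 : ℝ)) * √(2 * R) * ‖p‖ := by rw [hc]; ring
      _ ≤ ε / 2 * ‖p‖ := by gcongr
  linarith

end Approximation

/-! ### Reduction of a continuous path to the step path, and the main theorem. -/

section Path

variable {n : ℕ} {A : ℝ → Matrix (Fin n) (Fin n) ℝ} {Am Ap : Matrix (Fin n) (Fin n) ℝ}

theorem stepPath_diff_vanishes (hm : Tendsto A atBot (𝓝 Am)) (hp : Tendsto A atTop (𝓝 Ap))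
    {ε : ℝ} (hε : 0 < ε) :
    ∃ R : ℕ, ∀ t, (R : ℝ) ≤ |t| → ‖act (A t) - stepPath (act Am) (act Ap) t‖ ≤ ε := by
  have h1 : ∀ᶠ t in atBot, ‖act (A t) - act Am‖ ≤ ε := by
    have : Tendsto (fun t => ‖act (A t) - act Am‖) atBot (𝓝 ‖act Am - act Am‖) :=
      (((continuous_act.tendsto Am).comp hm).sub_const _).norm
    rw [sub_self, norm_zero] at this
    exact this.eventually_le_const hε
  have h2 : ∀ᶠ t in atTop, ‖act (A t) - act Ap‖ ≤ ε := by
    have : Tendsto (fun t => ‖act (A t) - act Ap‖) atTop (𝓝 ‖act Ap - act Ap‖) :=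
      (((continuous_act.tendsto Ap).comp hp).sub_const _).norm
    rw [sub_self, norm_zero] at this
    exact this.eventually_le_const hε
  obtain ⟨a, ha⟩ := eventually_atBot.1 h1
  obtain ⟨b, hb⟩ := eventually_atTop.1 h2
  obtain ⟨R, hR⟩ := exists_nat_ge (max (-a) b)
  refine ⟨R, fun t ht => ?_⟩
  have hRa := (le_max_left _ _).trans hR
  have hRb := (le_max_right _ _).trans hR
  rcases lt_or_ge t 0 with h | h
  · rw [abs_of_neg h] at ht
    rw [stepPath, glue_of_neg h]
    exact ha t (by linarith)
  · rw [abs_of_nonneg h] at ht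
    rw [stepPath, glue_of_nonneg h]
    exact hb t (by linarith)

/-- The path differs from the step path by a multiplier that vanishes at infinity. This difference
may jump at 0, which is why multipliers are only required to be measurable. Only the limits need to
be symmetric, not `A t`. -/
theorem isFredholm_opF (hAm : Am.IsSymm) (hAp : Ap.IsSymm) (hAm' : IsUnit Am) (hAp' : IsUnit Ap)
    (hA : Continuous A) (hm : Tendsto A atBot (𝓝 Am)) (hp : Tendsto A atTop (𝓝 Ap))
    (hb : ∃ C, ∀ t, ‖act (A t)‖ ≤ C) :
    (opF A hA hb).IsFredholm ∧
      fredholmIndex (opF A hA hb) = (negInd Am : ℤ) - (negInd Ap : ℤ) := by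
  obtain ⟨bm, wm, hdm, hnm⟩ := exists_isDiagonal Am hAm hAm'
  obtain ⟨bp, wp, hdp, hnp⟩ := exists_isDiagonal Ap hAp hAp'
  have hB : IsMultiplier fun t => act (A t) :=
    ⟨(continuous_act.comp hA).aestronglyMeasurable, hb⟩
  have hB₀ := isMultiplier_stepPath (Sm := act Am) (Sp := act Ap)
  have hD : IsMultiplier fun t => act (A t) - stepPath (act Am) (act Ap) t := by
    refine ⟨hB.meas.sub hB₀.meas, ?_⟩
    obtain ⟨C, hC⟩ := hB.bound
    obtain ⟨C', hC'⟩ := hB₀.bound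
    exact ⟨C + C', fun t => (norm_sub_le _ _).trans (add_le_add (hC t) (hC' t))⟩
  have e : opF A hA hb = lineOp hB₀ + (multOp hD).comp (W12.incl n) := by
    ext1 p
    -- `mulOp` and `multOp` both send f to the class of t ↦ A(t) f(t), so `opF` is definitionally
    -- `lineOp hB`.
    change W12.dt n p + multOp hB (W12.incl n p) =
      W12.dt n p + multOp hB₀ (W12.incl n p) + multOp hD (W12.incl n p)
    rw [add_assoc]
    congr 1
    refine Lp.ext ?_
    filter_upwards [multOp_ae hB (W12.incl n p), multOp_ae hB₀ (W12.incl n p),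
      multOp_ae hD (W12.incl n p), Lp.coeFn_add (multOp hB₀ (W12.incl n p))
        (multOp hD (W12.incl n p))] with t h1 h2 h3 h4
    rw [h1, h4, Pi.add_apply, h2, h3, ← add_apply]
    congr 1
    abel
  obtain ⟨h1, h2⟩ := IsFredholm.add_of_approx (isFredholm_model hdm hdp)
    (K := (multOp hD).comp (W12.incl n))
    (fun ε hε => exists_finiteRange_approx hD (fun _ h => stepPath_diff_vanishes hm hp h) hε)
  rw [e]
  refine ⟨h1, ?_⟩
  rw [h2, fredholmIndex_model hdm hdp, hnm, hnp]

end Path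

end FredholmLine

open FredholmLine in
theorem mainTheorem7 (n : ℕ) (Am Ap : Matrix (Fin n) (Fin n) ℝ)
    (hAm : Am.IsSymm) (hAp : Ap.IsSymm) (hAm' : IsUnit Am) (hAp' : IsUnit Ap) :
    (∀ (A : ℝ → Matrix (Fin n) (Fin n) ℝ) (hA : Continuous A)
      (hm : Tendsto A atBot (𝓝 Am)) (hp : Tendsto A atTop (𝓝 Ap)),
      (opF A hA (exists_bound hA hm hp)).IsFredholm ∧
      fredholmIndex (opF A hA (exists_bound hA hm hp)) = (negInd Am : ℤ) - (negInd Ap : ℤ)) ∧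
    (∀ (l : ℕ) (A : (Fin l → unitInterval) → ℝ → Matrix (Fin n) (Fin n) ℝ)
      (hA : ∀ s, Continuous (A s))
      (hm : ∀ s, Tendsto (A s) atBot (𝓝 Am)) (hp : ∀ s, Tendsto (A s) atTop (𝓝 Ap))
      (s : Fin l → unitInterval) (K : EuclideanSpace ℝ (Fin l) →L[ℝ] L2 n),
      (opFParam l (A s) (hA s) (exists_bound (hA s) (hm s) (hp s)) K).IsFredholm ∧
      fredholmIndex (opFParam l (A s) (hA s) (exists_bound (hA s) (hm s) (hp s)) K) =
        (negInd Am : ℤ) - (negInd Ap : ℤ) + (l : ℤ)) := by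
  refine ⟨fun A hA hm hp => isFredholm_opF hAm hAp hAm' hAp' hA hm hp _, ?_⟩
  intro l A hA hm hp s K
  obtain ⟨h1, h2⟩ := isFredholm_opF hAm hAp hAm' hAp' (hA s) (hm s) (hp s)
    (exists_bound (hA s) (hm s) (hp s))
  -- The parameter value s is fixed, so `A s` is a single path as in the first part; K affects
  -- neither the Fredholm property nor the index.
  obtain ⟨h3, h4⟩ := IsFredholm.coprod h1 K
  refine ⟨h3, h4.trans ?_⟩
  rw [h2, finrank_euclideanSpace_fin]
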